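/- Theorem 3.1 (Weierstrass–Enneper decomposition, minimal surfaces). Let $U\subset\mathbb R^2$ be open, let $u\in C^2(U)$ satisfy the minimal surface equation $(1+u_x^2)u_{yy}-2u_xu_yu_{xy}+(1+u_y^2)u_{xx}=0$, and let $p=(x_0,y_0)\in U$ be such that $(p,u(p))$ is a non-umbilical point of the graph $z=u(x,y)$. For a function $R$ holomorphic on a disc $D=D(\zeta_0,r)\subset\mathbb C$, $r>0$, and $c\in\mathbb R$ put, for $\zeta\in D$, $$x_R(\zeta)=x_0+\mathrm{Re}\int_{\zeta_0}^{\zeta}(1-w^2)R(w)\,dw,\quad y_R(\zeta)=y_0+\mathrm{Re}\int_{\zeta_0}^{\zeta}i(1+w^2)R(w)\,dw,\quad z_{R,c}(\zeta)=c+\mathrm{Re}\int_{\zeta_0}^{\zeta}2wR(w)\,dw .$$ Call $R$ a Weierstrass–Enneper function of the graph at $p$ on $D$ if $R$ is holomorphic and non-vanishing on $D$ and, for all $\zeta\in D$, $(x_R(\zeta),y_R(\zeta))\in U$ and $u(x_R(\zeta),y_R(\zeta))=z_{R,u(p)}(\zeta)$. Call $(R_1,\dots,R_n)$ a splitting of $R$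 if the $R_i$ are holomorphic and non-vanishing on $D$ and $R=R_1+\dots+R_n$ on $D$. Then: (a) The graph has a Weierstrass–Enneper function at $p$ on some disc $D=D(\zeta_0,r)$. For every Weierstrass–Enneper function $R$ of the graph at $p$, on any disc $D=D(\zeta_0,r)$: (b) For every $n\ge 1$, $R$ has a splitting $(R_1,\dots,R_n)$. (c) For every splitting $(R_1,\dots,R_n)$ of $R$ and all real $c_1,\dots,c_n$ with $c_1+\dots+c_n=u(p)$ there are an open neighbourhood $U'\subset U$ of $p$, a disc $D'=D(\zeta_0,\rho)\subset D$, $0<\rho\le r$, and functions $z_1,\dots,z_n:U'\to\mathbb R$ with $$u(x,y)=z_1(x,y)+\dots+z_n(x,y)\qquad((x,y)\in U')$$ such that $(x_R,y_R)$ maps $D'$ diffeomorphically onto $U'$, with inverse $\Phi_0$; $z_i=z_{R_i,c_i}\circ\Phi_0$ on $U'$ for each $i$; and, for each $i$, $(x_i,y_i):=(x_{R_i},y_{R_i})$ maps $D'$ diffeomorphically onto an open set $W_i\subset\mathbb R^2$, with inverse $\Phi_i:W_i\to D'$, and $z_{R_i,c_i}\circ\Phi_i:W_i\to\mathbb R$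 is a $C^2$ solution of the minimal surface equation in the coordinates $(x_i,y_i)$. (d) For $n\ge 2$ the decomposition is not unique: for every decomposition $u=z_1+\dots+z_n$ as in (c) there is another one, $u=z_1'+\dots+z_n'$, also as in (c) for the same $R$ and $n$ (with its own splitting, constants and neighbourhood of $p$), such that for no permutation $\sigma$ of $\{1,\dots,n\}$ are all the differences $z_i'-z_{\sigma(i)}$ constant near $p$. -/

import Mathlib

open scoped ContDiff

noncomputable section

namespace MinimalGraph

/-- Partial derivative with respect to the first coordinate `x`. -/
def dx (u : ℝ × ℝ → ℝ) (q : ℝ × ℝ) : ℝ := fderiv ℝ u q (1, 0)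

/-- Partial derivative with respect to the second coordinate `y`. -/
def dy (u : ℝ × ℝ → ℝ) (q : ℝ × ℝ) : ℝ := fderiv ℝ u q (0, 1)

/-- `z = u (x, y)`, `(x, y) ∈ U`, is (the height function of) a minimal surface: `u` is twice
continuously differentiable on `U` and solves the minimal surface equation there.
Used for open `U` only. -/
structure IsMinimalGraph (u : ℝ × ℝ → ℝ) (U : Set (ℝ × ℝ)) : Prop where
  contDiffOn : ContDiffOn ℝ 2 u U
  equation : ∀ q ∈ U,
    (1 + dx u q ^ 2) * dy (dy u) q - 2 * dx u q * dy u q * dx (dy u) q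
      + (1 + dy u q ^ 2) * dx (dx u) q = 0

/-- The area density `√(1 + u_x² + u_y²)` of the graph of `u`. -/
def areaDensity (u : ℝ × ℝ → ℝ) (q : ℝ × ℝ) : ℝ := Real.sqrt (1 + dx u q ^ 2 + dy u q ^ 2)

/-- The point of the graph of `u` above `q` is umbilical: the second fundamental form
`(u_xx, u_xy, u_yy) / √(1 + u_x² + u_y²)` is a multiple `κ` of the first fundamental form
`(1 + u_x², u_x u_y, 1 + u_y²)`, that is, both principal curvatures equal `κ`. -/
def IsUmbilic (u : ℝ × ℝ → ℝ) (q : ℝ × ℝ) : Prop :=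
  ∃ κ : ℝ,
    dx (dx u) q / areaDensity u q = κ * (1 + dx u q ^ 2) ∧
    dx (dy u) q / areaDensity u q = κ * (dx u q * dy u q) ∧
    dy (dy u) q / areaDensity u q = κ * (1 + dy u q ^ 2)

/-- The integral `∫ φ(w) dw` along the segment from `ζ₀` to `ζ`. It is only used for `φ` holomorphic
on a disc about `ζ₀` that contains `ζ`, where it is the integral along any path in the disc. -/
def segIntegral (φ : ℂ → ℂ) (ζ₀ ζ : ℂ) : ℂ :=
  ∫ t in (0 : ℝ)..1, φ (ζ₀ + (t : ℂ) * (ζ - ζ₀)) * (ζ - ζ₀)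

/-- The first two Weierstrass–Enneper coordinates `(x, y)` with Weierstrass–Enneper function `R`
and base point `(x₀, y₀) = p`. -/
def wePlane (p : ℝ × ℝ) (ζ₀ : ℂ) (R : ℂ → ℂ) (ζ : ℂ) : ℝ × ℝ :=
  (p.1 + (segIntegral (fun w => (1 - w ^ 2) * R w) ζ₀ ζ).re,
   p.2 + (segIntegral (fun w => Complex.I * (1 + w ^ 2) * R w) ζ₀ ζ).re)

/-- The third Weierstrass–Enneper coordinate `z` with Weierstrass–Enneper function `R`
and base height `z₀ = c`. -/
def weHeight (c : ℝ) (ζ₀ : ℂ) (R : ℂ → ℂ) (ζ : ℂ) : ℝ :=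
  c + (segIntegral (fun w => 2 * w * R w) ζ₀ ζ).re

/-- `R`, holomorphic and non-vanishing on the disc of radius `r` about `ζ₀`, is a
Weierstrass–Enneper function of the graph of `u` over `U` near the point above `p`. -/
structure IsWERepresentation (u : ℝ × ℝ → ℝ) (U : Set (ℝ × ℝ)) (p : ℝ × ℝ)
    (ζ₀ : ℂ) (r : ℝ) (R : ℂ → ℂ) : Prop where
  pos : 0 < r
  holomorphic : DifferentiableOn ℂ R (Metric.ball ζ₀ r)
  ne_zero : ∀ ζ ∈ Metric.ball ζ₀ r, R ζ ≠ 0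
  mem : ∀ ζ ∈ Metric.ball ζ₀ r, wePlane p ζ₀ R ζ ∈ U
  height : ∀ ζ ∈ Metric.ball ζ₀ r, u (wePlane p ζ₀ R ζ) = weHeight (u p) ζ₀ R ζ

/-- `R = S 0 + ⋯ + S (n - 1)` on the disc of radius `r` about `ζ₀`, each `S i` being holomorphic
and non-vanishing there. -/
structure IsSplitting {n : ℕ} (ζ₀ : ℂ) (r : ℝ) (R : ℂ → ℂ) (S : Fin n → ℂ → ℂ) : Prop where
  holomorphic : ∀ i, DifferentiableOn ℂ (S i) (Metric.ball ζ₀ r)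
  ne_zero : ∀ i, ∀ ζ ∈ Metric.ball ζ₀ r, S i ζ ≠ 0
  sum_eq : ∀ ζ ∈ Metric.ball ζ₀ r, R ζ = ∑ i, S i ζ

/-- `Φ` is a diffeomorphism, from an open set of the plane onto the open set `Ω` of parameters,
whose inverse is the restriction of `X` to `Ω`. -/
structure IsInverseDiffeo (Φ : OpenPartialHomeomorph (ℝ × ℝ) ℂ) (X : ℂ → ℝ × ℝ)
    (Ω : Set ℂ) : Prop where
  target_eq : Φ.target = Ω
  symm_eq : ∀ ζ ∈ Ω, Φ.symm ζ = X ζ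
  smooth : ContDiffOn ℝ ∞ Φ Φ.source
  smooth_symm : ContDiffOn ℝ ∞ Φ.symm Φ.target

/-- `u = z 0 + ⋯ + z (n - 1)` on the neighbourhood `U'` of `p` is the decomposition of the height
function `u` that belongs to the splitting `S` of its Weierstrass–Enneper function `R` and to the
base heights `c i`. Here `Φ₀ (x, y)` is the parameter `ζ` of the point `(x, y)` of `U'`; as a function
of `ζ`, the summand `z i` is the third Weierstrass–Enneper coordinate given by `S i`; and `Φ i` is the
inverse of the map `ζ ↦ (x_i, y_i)` given by the first two, so that `z i`, expressed in the
coordinates `(x_i, y_i)` by means of `Φ i`, is the height function of a minimal surface. -/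
structure IsDecomposition {n : ℕ} (u : ℝ × ℝ → ℝ) (U : Set (ℝ × ℝ)) (p : ℝ × ℝ)
    (ζ₀ : ℂ) (r : ℝ) (R : ℂ → ℂ) (S : Fin n → ℂ → ℂ) (c : Fin n → ℝ)
    (U' : Set (ℝ × ℝ)) (z : Fin n → ℝ × ℝ → ℝ) : Prop where
  isOpen : IsOpen U'
  mem : p ∈ U'
  subset : U' ⊆ U
  sum_eq : ∀ q ∈ U', u q = ∑ i, z i q
  coordinates : ∃ (ρ : ℝ) (Φ₀ : OpenPartialHomeomorph (ℝ × ℝ) ℂ)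
    (Φ : Fin n → OpenPartialHomeomorph (ℝ × ℝ) ℂ),
    0 < ρ ∧ ρ ≤ r ∧
    Φ₀.source = U' ∧ IsInverseDiffeo Φ₀ (wePlane p ζ₀ R) (Metric.ball ζ₀ ρ) ∧
    (∀ i, ∀ q ∈ U', z i q = weHeight (c i) ζ₀ (S i) (Φ₀ q)) ∧
    (∀ i, IsInverseDiffeo (Φ i) (wePlane p ζ₀ (S i)) (Metric.ball ζ₀ ρ)) ∧
    (∀ i, IsMinimalGraph (fun q => weHeight (c i) ζ₀ (S i) (Φ i q)) (Φ i).source)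

/-- Two families of summands are essentially the same near `p`: up to reordering and up to additive
constants, they agree in a neighbourhood of `p`. -/
def EssentiallyEqual {n : ℕ} (p : ℝ × ℝ) (z z' : Fin n → ℝ × ℝ → ℝ) : Prop :=
  ∃ σ : Equiv.Perm (Fin n), ∀ i, ∃ k : ℝ, ∀ᶠ q in nhds p, z' i q = z (σ i) q + k

end MinimalGraph

end

noncomputable section

namespace MinimalGraph

open Metric Filter
open scoped Topology

/-! The parameter `ζ` is the stereographic image of the surface normal. The vector `(1 - ζ², i(1 +
ζ²), 2ζ)` is annihilated by `(slopeX ζ, slopeY ζ, -1)` (`slope_relation`), so the slopes of a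
Weierstrass–Enneper surface depend on `ζ` and not on `R`. The planar part is an immersion wherever
`R ≠ 0` and `|ζ| ≠ 1` (`wePlaneDeriv_injective`), and differentiating the slopes through its local
inverse yields the minimal surface equation (`isMinimalGraph_weHeight_comp`).

If `R` represents a graph, then `|ζ| ≠ 1` on the disc, because a graph has no vertical tangent. This
condition does not involve `R`, so it serves every summand of a splitting. As the height is linear
in `R` up to its base constant, splitting `R` splits `u`. A summand determines its function at `ζ₀`
(`eq_of_eventually_weHeight_eq_add`), so constant multiples of `R` with a weight outside a finite
set give an essentially different decomposition.

For existence, a non-umbilical point has non-degenerate Hessian, so the Gauss map is locally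
invertible and its inverse supplies the parameter. The minimal surface equation makes two one-forms
closed, giving conjugates `f`, `g` of `x`, `y`; `x + if` and `y + ig` are holomorphic in `ζ`
(`conjugate_relations`), and their derivatives share the factor `R` (`we_proportional`). -/

/-- The real-linear functional `v ↦ Re (φ v)` on `ℂ`. -/
def reMul (φ : ℂ) : ℂ →L[ℝ] ℝ := Complex.reCLM.comp (ContinuousLinearMap.mul ℝ ℂ φ)

@[simp] lemma reMul_apply (φ v : ℂ) : reMul φ v = (φ * v).re := rfl

lemma hasFDerivAt_re_of_hasDerivAt {F : ℂ → ℂ} {φ ζ : ℂ} (h : HasDerivAt F φ ζ) :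
    HasFDerivAt (fun w => (F w).re) (reMul φ) ζ := by
  have h1 := Complex.reCLM.hasFDerivAt.comp ζ (h.hasFDerivAt.restrictScalars ℝ)
  refine h1.congr_fderiv ?_
  ext v
  simp [mul_comm]

/-! ### Primitives on a disc -/

section segIntegral

variable {ζ₀ : ℂ} {r : ℝ} {φ : ℂ → ℂ}

lemma add_mul_sub_mem_ball {ζ : ℂ} (hζ : ζ ∈ ball ζ₀ r) {t : ℝ} (ht : t ∈ Set.Icc (0 : ℝ) 1) :
    ζ₀ + (t : ℂ) * (ζ - ζ₀) ∈ ball ζ₀ r := by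
  have h0 : ζ₀ ∈ ball ζ₀ r := mem_ball_self (dist_nonneg.trans_lt hζ)
  have := (convex_ball ζ₀ r).add_smul_sub_mem h0 hζ ht
  simpa using this

lemma continuousOn_segment_integrand (hφ : ContinuousOn φ (ball ζ₀ r)) {ζ : ℂ}
    (hζ : ζ ∈ ball ζ₀ r) :
    ContinuousOn (fun t : ℝ => φ (ζ₀ + (t : ℂ) * (ζ - ζ₀)) * (ζ - ζ₀)) (Set.uIcc 0 1) := by
  rw [Set.uIcc_of_le zero_le_one]
  refine ContinuousOn.mul (hφ.comp (by fun_prop) fun t ht => ?_) continuousOn_const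
  exact add_mul_sub_mem_ball hζ ht

lemma segIntegral_eq_sub (hφ : ContinuousOn φ (ball ζ₀ r)) {F : ℂ → ℂ}
    (hF : ∀ ζ ∈ ball ζ₀ r, HasDerivAt F (φ ζ) ζ) {ζ : ℂ} (hζ : ζ ∈ ball ζ₀ r) :
    segIntegral φ ζ₀ ζ = F ζ - F ζ₀ := by
  have key := intervalIntegral.integral_eq_sub_of_hasDerivAt (a := 0) (b := 1)
    (f := fun t : ℝ => F (ζ₀ + (t : ℂ) * (ζ - ζ₀)))
    (f' := fun t : ℝ => φ (ζ₀ + (t : ℂ) * (ζ - ζ₀)) * (ζ - ζ₀)) ?_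
    (continuousOn_segment_integrand hφ hζ).intervalIntegrable
  · simpa [segIntegral] using key
  · intro t ht
    rw [Set.uIcc_of_le zero_le_one] at ht
    have h1 : HasDerivAt (fun t : ℝ => ζ₀ + (t : ℂ) * (ζ - ζ₀)) (ζ - ζ₀) t := by
      simpa using ((Complex.ofRealCLM.hasDerivAt (x := t)).mul_const (ζ - ζ₀)).const_add ζ₀
    exact (hF _ (add_mul_sub_mem_ball hζ ht)).comp t h1

@[simp] lemma segIntegral_self (φ : ℂ → ℂ) (ζ₀ : ℂ) : segIntegral φ ζ₀ ζ₀ = 0 := by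
  simp [segIntegral]

/-- A holomorphic function on a disc has a primitive, and the segment integral differs from it by a
constant; no differentiation under the integral is needed. -/
lemma hasDerivAt_segIntegral (hφ : DifferentiableOn ℂ φ (ball ζ₀ r)) {ζ : ℂ}
    (hζ : ζ ∈ ball ζ₀ r) : HasDerivAt (segIntegral φ ζ₀) (φ ζ) ζ := by
  obtain ⟨F, hF⟩ := hφ.isExactOn_ball
  refine ((hF ζ hζ).sub_const (F ζ₀)).congr_of_eventuallyEq ?_
  filter_upwards [isOpen_ball.mem_nhds hζ] with w hw
  exact segIntegral_eq_sub hφ.continuousOn hF hw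

lemma segIntegral_sum {ι : Type*} (s : Finset ι) {f : ι → ℂ → ℂ}
    (hf : ∀ i ∈ s, ContinuousOn (f i) (ball ζ₀ r))
    (h : ∀ ζ ∈ ball ζ₀ r, φ ζ = ∑ i ∈ s, f i ζ) {ζ : ℂ} (hζ : ζ ∈ ball ζ₀ r) :
    segIntegral φ ζ₀ ζ = ∑ i ∈ s, segIntegral (f i) ζ₀ ζ := by
  unfold segIntegral
  rw [← intervalIntegral.integral_finsetSum fun i hi =>
    (continuousOn_segment_integrand (hf i hi) hζ).intervalIntegrable]
  refine intervalIntegral.integral_congr fun t ht => ?_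
  rw [Set.uIcc_of_le zero_le_one] at ht
  simp only [h _ (add_mul_sub_mem_ball hζ ht), Finset.sum_mul]

end segIntegral

/-! ### Slopes as functions of the parameter -/

/-- The slope `u_x` of a surface with Weierstrass–Enneper parameter `ζ`. -/
def slopeX (ζ : ℂ) : ℝ := 2 * ζ.re / (1 - ζ.re ^ 2 - ζ.im ^ 2)

/-- The slope `u_y` of a surface with Weierstrass–Enneper parameter `ζ`. -/
def slopeY (ζ : ℂ) : ℝ := 2 * ζ.im / (1 - ζ.re ^ 2 - ζ.im ^ 2)

lemma slope_relation {ζ : ℂ} (hζ : 1 - ζ.re ^ 2 - ζ.im ^ 2 ≠ 0) :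
    (slopeX ζ : ℂ) * (1 - ζ ^ 2) + slopeY ζ * (Complex.I * (1 + ζ ^ 2)) = 2 * ζ := by
  apply Complex.ext <;> simp [pow_two] <;> simp only [slopeX, slopeY] <;> field_simp <;> ring

lemma slopeX_mul_re_add_slopeY_mul_re {ζ : ℂ} (hζ : 1 - ζ.re ^ 2 - ζ.im ^ 2 ≠ 0) (ρ v : ℂ) :
    slopeX ζ * ((1 - ζ ^ 2) * ρ * v).re + slopeY ζ * (Complex.I * (1 + ζ ^ 2) * ρ * v).re
      = (2 * ζ * ρ * v).re := by
  rw [← Complex.re_ofReal_mul, ← Complex.re_ofReal_mul, ← Complex.add_re, ← slope_relation hζ]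
  congr 1
  ring

lemma hasFDerivAt_div {V : Type*} [NormedAddCommGroup V] [NormedSpace ℝ V] {f g : V → ℝ}
    {f' g' : V →L[ℝ] ℝ} {x : V} (hf : HasFDerivAt f f' x) (hg : HasFDerivAt g g' x)
    (hx : g x ≠ 0) :
    HasFDerivAt (fun y => f y / g y) ((g x)⁻¹ • f' - (f x / g x ^ 2) • g') x := by
  have h := hf.mul ((hasDerivAt_inv hx).comp_hasFDerivAt x hg)
  refine HasFDerivAt.congr_fderiv (f := fun y => f y / g y) h ?_
  ext v
  simp
  field_simp
  ring

/-- The derivatives of the slopes as functions of the parameter. -/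
lemma hasFDerivAt_slopeX {ζ : ℂ} (hζ : 1 - ζ.re ^ 2 - ζ.im ^ 2 ≠ 0) :
    HasFDerivAt slopeX
      ((2 * (1 + ζ.re ^ 2 - ζ.im ^ 2) / (1 - ζ.re ^ 2 - ζ.im ^ 2) ^ 2) • Complex.reCLM
        + (4 * ζ.re * ζ.im / (1 - ζ.re ^ 2 - ζ.im ^ 2) ^ 2) • Complex.imCLM) ζ := by
  have hre : HasFDerivAt Complex.re Complex.reCLM ζ := Complex.reCLM.hasFDerivAt
  have him : HasFDerivAt Complex.im Complex.imCLM ζ := Complex.imCLM.hasFDerivAt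
  have h := hasFDerivAt_div (hre.const_mul 2) (((hre.pow 2).const_sub 1).sub (him.pow 2)) hζ
  refine h.congr_fderiv (ContinuousLinearMap.ext fun v => ?_)
  simp
  field_simp
  ring

lemma hasFDerivAt_slopeY {ζ : ℂ} (hζ : 1 - ζ.re ^ 2 - ζ.im ^ 2 ≠ 0) :
    HasFDerivAt slopeY
      ((4 * ζ.re * ζ.im / (1 - ζ.re ^ 2 - ζ.im ^ 2) ^ 2) • Complex.reCLM
        + (2 * (1 - ζ.re ^ 2 + ζ.im ^ 2) / (1 - ζ.re ^ 2 - ζ.im ^ 2) ^ 2) • Complex.imCLM) ζ := by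
  have hre : HasFDerivAt Complex.re Complex.reCLM ζ := Complex.reCLM.hasFDerivAt
  have him : HasFDerivAt Complex.im Complex.imCLM ζ := Complex.imCLM.hasFDerivAt
  have h := hasFDerivAt_div (him.const_mul 2) (((hre.pow 2).const_sub 1).sub (him.pow 2)) hζ
  refine h.congr_fderiv (ContinuousLinearMap.ext fun v => ?_)
  simp
  field_simp
  ring

/-! ### The Weierstrass–Enneper parametrization and its derivative -/

section WeierstrassEnneper

variable {p : ℝ × ℝ} {c : ℝ} {ζ₀ : ℂ} {r : ℝ} {R : ℂ → ℂ}

lemma differentiableOn_weX (hR : DifferentiableOn ℂ R (ball ζ₀ r)) :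
    DifferentiableOn ℂ (fun w => (1 - w ^ 2) * R w) (ball ζ₀ r) := by fun_prop

lemma differentiableOn_weY (hR : DifferentiableOn ℂ R (ball ζ₀ r)) :
    DifferentiableOn ℂ (fun w => Complex.I * (1 + w ^ 2) * R w) (ball ζ₀ r) := by fun_prop

lemma differentiableOn_weZ (hR : DifferentiableOn ℂ R (ball ζ₀ r)) :
    DifferentiableOn ℂ (fun w => 2 * w * R w) (ball ζ₀ r) := by fun_prop

@[simp] lemma wePlane_self : wePlane p ζ₀ R ζ₀ = p := by simp [wePlane]

@[simp] lemma weHeight_self : weHeight c ζ₀ R ζ₀ = c := by simp [weHeight]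

/-- The derivative of the planar part of the Weierstrass–Enneper parametrization. -/
def wePlaneDeriv (ζ ρ : ℂ) : ℂ →L[ℝ] ℝ × ℝ :=
  (reMul ((1 - ζ ^ 2) * ρ)).prod (reMul (Complex.I * (1 + ζ ^ 2) * ρ))

lemma hasFDerivAt_wePlane (hR : DifferentiableOn ℂ R (ball ζ₀ r)) {ζ : ℂ} (hζ : ζ ∈ ball ζ₀ r) :
    HasFDerivAt (wePlane p ζ₀ R) (wePlaneDeriv ζ (R ζ)) ζ :=
  ((hasFDerivAt_re_of_hasDerivAt
      (hasDerivAt_segIntegral (differentiableOn_weX hR) hζ)).const_add p.1).prodMk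
    ((hasFDerivAt_re_of_hasDerivAt
      (hasDerivAt_segIntegral (differentiableOn_weY hR) hζ)).const_add p.2)

lemma hasFDerivAt_weHeight (hR : DifferentiableOn ℂ R (ball ζ₀ r)) {ζ : ℂ} (hζ : ζ ∈ ball ζ₀ r) :
    HasFDerivAt (weHeight c ζ₀ R) (reMul (2 * ζ * R ζ)) ζ :=
  (hasFDerivAt_re_of_hasDerivAt (hasDerivAt_segIntegral (differentiableOn_weZ hR) hζ)).const_add c

lemma contDiffOn_re_segIntegral {φ : ℂ → ℂ} (hφ : DifferentiableOn ℂ φ (ball ζ₀ r)) :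
    ContDiffOn ℝ ∞ (fun ζ => (segIntegral φ ζ₀ ζ).re) (ball ζ₀ r) := by
  have h : DifferentiableOn ℂ (segIntegral φ ζ₀) (ball ζ₀ r) := fun ζ hζ =>
    (hasDerivAt_segIntegral hφ hζ).differentiableAt.differentiableWithinAt
  exact Complex.reCLM.contDiff.comp_contDiffOn
    ((h.contDiffOn (n := ∞) isOpen_ball).restrict_scalars ℝ)

lemma contDiffOn_wePlane (hR : DifferentiableOn ℂ R (ball ζ₀ r)) :
    ContDiffOn ℝ ∞ (wePlane p ζ₀ R) (ball ζ₀ r) :=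
  (contDiffOn_const.add (contDiffOn_re_segIntegral (differentiableOn_weX hR))).prodMk
    (contDiffOn_const.add (contDiffOn_re_segIntegral (differentiableOn_weY hR)))

lemma contDiffOn_weHeight (hR : DifferentiableOn ℂ R (ball ζ₀ r)) :
    ContDiffOn ℝ ∞ (weHeight c ζ₀ R) (ball ζ₀ r) :=
  contDiffOn_const.add (contDiffOn_re_segIntegral (differentiableOn_weZ hR))

/-- As a real-linear map of `ρ * v`, this has determinant `-(1 - |ζ|⁴) = -(1 - |ζ|²)(1 + |ζ|²)`. The
linear combinations below are Cramer's rule. -/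
lemma wePlaneDeriv_injective {ζ ρ : ℂ} (hζ : 1 - ζ.re ^ 2 - ζ.im ^ 2 ≠ 0) (hρ : ρ ≠ 0) :
    Function.Injective (wePlaneDeriv ζ ρ) := by
  rw [injective_iff_map_eq_zero]
  intro v hv
  have h1 : ((1 - ζ ^ 2) * (ρ * v)).re = 0 := by
    rw [← mul_assoc]; exact congrArg Prod.fst hv
  have h2 : (Complex.I * (1 + ζ ^ 2) * (ρ * v)).re = 0 := by
    rw [← mul_assoc]; exact congrArg Prod.snd hv
  suffices h : ρ * v = 0 from (mul_eq_zero.mp h).resolve_left hρ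
  generalize ρ * v = m at h1 h2
  have hpos : 1 + ζ.re ^ 2 + ζ.im ^ 2 ≠ 0 := by positivity
  simp [pow_two] at h1 h2
  apply Complex.ext
  · apply (mul_eq_zero.mp _).resolve_left (mul_ne_zero hζ hpos)
    simp only [pow_two]
    linear_combination (1 + ζ.re * ζ.re - ζ.im * ζ.im) * h1 + 2 * ζ.re * ζ.im * h2
  · apply (mul_eq_zero.mp _).resolve_left (mul_ne_zero hζ hpos)
    simp only [pow_two]
    linear_combination (-2 * ζ.re * ζ.im) * h1 - (1 - ζ.re * ζ.re + ζ.im * ζ.im) * h2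

end WeierstrassEnneper

/-! ### Local inversion of the planar part -/

lemma exists_equiv_of_injective {V W : Type*} [NormedAddCommGroup V] [NormedSpace ℝ V]
    [NormedAddCommGroup W] [NormedSpace ℝ W] [FiniteDimensional ℝ V] [FiniteDimensional ℝ W]
    (h : Module.finrank ℝ V = Module.finrank ℝ W) {L : V →L[ℝ] W} (hL : Function.Injective L) :
    ∃ e : V ≃L[ℝ] W, (e : V →L[ℝ] W) = L :=
  ⟨(LinearEquiv.ofInjectiveOfFinrankEq (L : V →ₗ[ℝ] W) hL h).toContinuousLinearEquiv, by
    ext v; rfl⟩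

/-- A smooth map of the plane with injective derivatives restricts to diffeomorphisms of all small
discs about a given point. -/
lemma exists_isInverseDiffeo {X : ℂ → ℝ × ℝ} {X' : ℂ → ℂ →L[ℝ] ℝ × ℝ} {ζ₀ : ℂ} {r : ℝ} (hr : 0 < r)
    (hX : ContDiffOn ℝ ∞ X (ball ζ₀ r)) (hX' : ∀ ζ ∈ ball ζ₀ r, HasFDerivAt X (X' ζ) ζ)
    (hinj : ∀ ζ ∈ ball ζ₀ r, Function.Injective (X' ζ)) :
    ∃ ρ₀ > 0, ∀ ρ, ρ ≤ ρ₀ →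
      ∃ Φ : OpenPartialHomeomorph (ℝ × ℝ) ℂ, IsInverseDiffeo Φ X (ball ζ₀ ρ) := by
  have hequiv : ∀ ζ ∈ ball ζ₀ r, ∃ e : ℂ ≃L[ℝ] ℝ × ℝ, HasFDerivAt X (e : ℂ →L[ℝ] ℝ × ℝ) ζ := by
    intro ζ hζ
    obtain ⟨e, he⟩ := exists_equiv_of_injective (by simp) (hinj ζ hζ)
    exact ⟨e, he ▸ hX' ζ hζ⟩
  have hsm : ∀ ζ ∈ ball ζ₀ r, ContDiffAt ℝ ∞ X ζ := fun ζ hζ =>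
    hX.contDiffAt (isOpen_ball.mem_nhds hζ)
  have h0 : ζ₀ ∈ ball ζ₀ r := mem_ball_self hr
  obtain ⟨e, he⟩ := hequiv ζ₀ h0
  set Ψ := (hsm ζ₀ h0).toOpenPartialHomeomorph X he (by simp) with hΨ
  have hΨX : ∀ ζ, Ψ ζ = X ζ := fun ζ => rfl
  obtain ⟨ε, hε, hεsub⟩ := Metric.isOpen_iff.mp Ψ.open_source ζ₀
    ((hsm ζ₀ h0).mem_toOpenPartialHomeomorph_source he (by simp))
  refine ⟨min ε r, lt_min hε hr, fun ρ hρ => ?_⟩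
  have hρr : ball ζ₀ ρ ⊆ ball ζ₀ r := ball_subset_ball (hρ.trans (min_le_right _ _))
  have hρε : ball ζ₀ ρ ⊆ Ψ.source := (ball_subset_ball (hρ.trans (min_le_left _ _))).trans hεsub
  set Θ := Ψ.restrOpen (ball ζ₀ ρ) isOpen_ball with hΘ
  have hsrc : Θ.source = ball ζ₀ ρ := by
    rw [hΘ, OpenPartialHomeomorph.restrOpen_source, Set.inter_eq_right.mpr hρε]
  refine ⟨Θ.symm, hsrc, fun ζ _ => rfl, fun q hq => ?_, ?_⟩
  · have hmem : Θ.symm q ∈ ball ζ₀ r := hρr (hsrc ▸ Θ.map_target hq)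
    obtain ⟨e', he'⟩ := hequiv _ hmem
    -- The inverse is smooth at each point because the derivative of `X` is invertible on the whole
    -- disc, not only at `ζ₀`.
    exact (Θ.contDiffAt_symm hq he' (hsm _ hmem)).contDiffWithinAt
  · change ContDiffOn ℝ ∞ X Θ.source
    rw [hsrc]
    exact hX.mono hρr

lemma clm_prod_apply (L : ℝ × ℝ →L[ℝ] ℝ) (v : ℝ × ℝ) :
    L v = L (1, 0) * v.1 + L (0, 1) * v.2 := by
  have hv : v = v.1 • ((1, 0) : ℝ × ℝ) + v.2 • ((0, 1) : ℝ × ℝ) := by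
    ext <;> simp
  conv_lhs => rw [hv]
  rw [map_add, map_smul, map_smul, smul_eq_mul, smul_eq_mul, mul_comm, mul_comm v.2]

/-- The tangent planes of a graph are never vertical. -/
lemma IsWERepresentation.one_sub_ne_zero {u : ℝ × ℝ → ℝ} {U : Set (ℝ × ℝ)} {p : ℝ × ℝ} {ζ₀ : ℂ}
    {r : ℝ} {R : ℂ → ℂ} (h : IsWERepresentation u U p ζ₀ r R) (hu : DifferentiableOn ℝ u U)
    (hU : IsOpen U) {ζ : ℂ} (hζ : ζ ∈ ball ζ₀ r) : 1 - ζ.re ^ 2 - ζ.im ^ 2 ≠ 0 := by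
  intro h1
  set q := wePlane p ζ₀ R ζ with hq
  have hud : HasFDerivAt u (fderiv ℝ u q) q :=
    (hu.differentiableAt (hU.mem_nhds (h.mem ζ hζ))).hasFDerivAt
  have hcomp := hud.comp ζ (hasFDerivAt_wePlane h.holomorphic hζ)
  have hev : u ∘ wePlane p ζ₀ R =ᶠ[𝓝 ζ] weHeight (u p) ζ₀ R := by
    filter_upwards [isOpen_ball.mem_nhds hζ] with w hw using h.height w hw
  have heq := hcomp.unique ((hasFDerivAt_weHeight h.holomorphic hζ).congr_of_eventuallyEq hev)
  have hR := h.ne_zero ζ hζ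
  -- When `|ζ| = 1`, this direction is vertical: `(1 - ζ²) ζ̄ = ζ̄ - ζ` and `i(1 + ζ²) ζ̄ = i(ζ̄ +
  -- ζ)` have real part `0`, while the height changes by `2|ζ|² = 2`.
  have hv := DFunLike.congr_fun heq (starRingEnd ℂ ζ / R ζ)
  rw [ContinuousLinearMap.comp_apply, clm_prod_apply] at hv
  simp only [wePlaneDeriv, ContinuousLinearMap.prod_apply, reMul_apply, mul_assoc,
    mul_div_cancel₀ _ hR] at hv
  simp [pow_two] at hv
  have e1 : (1 - (ζ.re * ζ.re - ζ.im * ζ.im)) * ζ.re - (ζ.re * ζ.im + ζ.im * ζ.re) * ζ.im = 0 := by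
    linear_combination ζ.re * h1
  have e2 : -((ζ.re * ζ.im + ζ.im * ζ.re) * ζ.re) + (1 + (ζ.re * ζ.re - ζ.im * ζ.im)) * ζ.im
      = 0 := by
    linear_combination ζ.im * h1
  have e3 : ζ.re * ζ.re + ζ.im * ζ.im = 1 := by linear_combination -h1
  have : (0 : ℝ) = 2 := by
    linear_combination hv - fderiv ℝ u q (1, 0) * e1 - fderiv ℝ u q (0, 1) * e2 + 2 * e3
  norm_num at this

namespace IsInverseDiffeo

variable {Φ : OpenPartialHomeomorph (ℝ × ℝ) ℂ} {X : ℂ → ℝ × ℝ} {Ω : Set ℂ}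

lemma mem_of_mem_source (h : IsInverseDiffeo Φ X Ω) {q : ℝ × ℝ} (hq : q ∈ Φ.source) : Φ q ∈ Ω :=
  h.target_eq ▸ Φ.map_source hq

lemma right_inv (h : IsInverseDiffeo Φ X Ω) {q : ℝ × ℝ} (hq : q ∈ Φ.source) : X (Φ q) = q := by
  rw [← h.symm_eq _ (h.mem_of_mem_source hq), Φ.left_inv hq]

lemma left_inv (h : IsInverseDiffeo Φ X Ω) {ζ : ℂ} (hζ : ζ ∈ Ω) : Φ (X ζ) = ζ := by
  rw [← h.symm_eq _ hζ, Φ.right_inv (h.target_eq ▸ hζ)]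

lemma map_mem_source (h : IsInverseDiffeo Φ X Ω) {ζ : ℂ} (hζ : ζ ∈ Ω) : X ζ ∈ Φ.source := by
  rw [← h.symm_eq _ hζ]
  exact Φ.map_target (h.target_eq ▸ hζ)

lemma hasFDerivAt (h : IsInverseDiffeo Φ X Ω) {q : ℝ × ℝ} (hq : q ∈ Φ.source) :
    HasFDerivAt Φ (fderiv ℝ Φ q) q :=
  ((h.smooth.differentiableOn (by simp)).differentiableAt (Φ.open_source.mem_nhds hq)).hasFDerivAt

lemma deriv_apply_deriv (h : IsInverseDiffeo Φ X Ω) {q : ℝ × ℝ} (hq : q ∈ Φ.source)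
    {X' : ℂ →L[ℝ] ℝ × ℝ} (hX : HasFDerivAt X X' (Φ q)) (v : ℝ × ℝ) :
    X' (fderiv ℝ Φ q v) = v := by
  have hid : X ∘ Φ =ᶠ[𝓝 q] id := by
    filter_upwards [Φ.open_source.mem_nhds hq] with q' hq' using h.right_inv hq'
  exact DFunLike.congr_fun
    ((hX.comp q (h.hasFDerivAt hq)).unique ((hasFDerivAt_id q).congr_of_eventuallyEq hid)) v

end IsInverseDiffeo

/-! ### Minimality of Weierstrass–Enneper graphs -/

/-- The minimal surface equation in terms of the derivatives `m`, `n` of the parameter with respect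
to the two coordinates. -/
lemma slope_equation {ζ s m n : ℂ} (hζ : 1 - ζ.re ^ 2 - ζ.im ^ 2 ≠ 0) (hs : s ≠ 0)
    (hm : wePlaneDeriv ζ s m = (1, 0)) (hn : wePlaneDeriv ζ s n = (0, 1)) :
    (1 + slopeX ζ ^ 2) *
        (4 * ζ.re * ζ.im / (1 - ζ.re ^ 2 - ζ.im ^ 2) ^ 2 * n.re
          + 2 * (1 - ζ.re ^ 2 + ζ.im ^ 2) / (1 - ζ.re ^ 2 - ζ.im ^ 2) ^ 2 * n.im)
      - 2 * slopeX ζ * slopeY ζ *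
        (4 * ζ.re * ζ.im / (1 - ζ.re ^ 2 - ζ.im ^ 2) ^ 2 * m.re
          + 2 * (1 - ζ.re ^ 2 + ζ.im ^ 2) / (1 - ζ.re ^ 2 - ζ.im ^ 2) ^ 2 * m.im)
      + (1 + slopeY ζ ^ 2) *
        (2 * (1 + ζ.re ^ 2 - ζ.im ^ 2) / (1 - ζ.re ^ 2 - ζ.im ^ 2) ^ 2 * m.re
          + 4 * ζ.re * ζ.im / (1 - ζ.re ^ 2 - ζ.im ^ 2) ^ 2 * m.im) = 0 := by
  have hm1 : ((1 - ζ ^ 2) * s * m).re = 1 := congrArg Prod.fst hm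
  have hm2 : (Complex.I * (1 + ζ ^ 2) * s * m).re = 0 := congrArg Prod.snd hm
  have hn1 : ((1 - ζ ^ 2) * s * n).re = 0 := congrArg Prod.fst hn
  have hn2 : (Complex.I * (1 + ζ ^ 2) * s * n).re = 1 := congrArg Prod.snd hn
  have hN : s.re ^ 2 + s.im ^ 2 ≠ 0 := by
    have := Complex.normSq_pos.mpr hs
    rw [Complex.normSq_apply] at this
    simp only [pow_two]
    exact this.ne'
  have hpos : 1 + ζ.re ^ 2 + ζ.im ^ 2 ≠ 0 := by positivity
  simp [pow_two] at hm1 hm2 hn1 hn2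
  simp only [slopeX, slopeY]
  generalize ζ.re = a at *
  generalize ζ.im = b at *
  obtain ⟨m₁, m₂⟩ := m
  obtain ⟨n₁, n₂⟩ := n
  obtain ⟨s, t⟩ := s
  simp only at *
  set K := (1 - a ^ 2 - b ^ 2) * (1 + a ^ 2 + b ^ 2) with hK
  have hK0 : K ≠ 0 := mul_ne_zero hζ hpos
  -- Cramer's rule with `K = 1 - |ζ|⁴` gives the complex products of `s + it` with the two
  -- derivatives; multiplying by the conjugate of `s + it` then isolates the derivatives.
  have M1 : (s * m₁ - t * m₂) * K = 1 + a ^ 2 - b ^ 2 := by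
    linear_combination (1 + a ^ 2 - b ^ 2) * hm1 + 2 * a * b * hm2
  have M2 : (s * m₂ + t * m₁) * K = -2 * a * b := by
    linear_combination (-2 * a * b) * hm1 - (1 - a ^ 2 + b ^ 2) * hm2
  have N1 : (s * n₁ - t * n₂) * K = 2 * a * b := by
    linear_combination (1 + a ^ 2 - b ^ 2) * hn1 + 2 * a * b * hn2
  have N2 : (s * n₂ + t * n₁) * K = -(1 - a ^ 2 + b ^ 2) := by
    linear_combination (-2 * a * b) * hn1 - (1 - a ^ 2 + b ^ 2) * hn2
  have hm₁ : m₁ = (s * (1 + a ^ 2 - b ^ 2) - t * (2 * a * b)) / (K * (s ^ 2 + t ^ 2)) := by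
    rw [eq_div_iff (mul_ne_zero hK0 hN)]
    linear_combination s * M1 + t * M2
  have hm₂ : m₂ = (-s * (2 * a * b) - t * (1 + a ^ 2 - b ^ 2)) / (K * (s ^ 2 + t ^ 2)) := by
    rw [eq_div_iff (mul_ne_zero hK0 hN)]
    linear_combination s * M2 - t * M1
  have hn₁ : n₁ = (s * (2 * a * b) - t * (1 - a ^ 2 + b ^ 2)) / (K * (s ^ 2 + t ^ 2)) := by
    rw [eq_div_iff (mul_ne_zero hK0 hN)]
    linear_combination s * N1 + t * N2
  have hn₂ : n₂ = (-s * (1 - a ^ 2 + b ^ 2) - t * (2 * a * b)) / (K * (s ^ 2 + t ^ 2)) := by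
    rw [eq_div_iff (mul_ne_zero hK0 hN)]
    linear_combination s * N2 - t * N1
  rw [hm₁, hm₂, hn₁, hn₂]
  field_simp
  ring

/-- The third Weierstrass–Enneper coordinate as a function of the first two is the height of a
minimal graph. -/
lemma isMinimalGraph_weHeight_comp {Φ : OpenPartialHomeomorph (ℝ × ℝ) ℂ} {p : ℝ × ℝ} {c : ℝ}
    {ζ₀ : ℂ} {ρ : ℝ} {S : ℂ → ℂ} (hS : DifferentiableOn ℂ S (ball ζ₀ ρ))
    (hS0 : ∀ ζ ∈ ball ζ₀ ρ, S ζ ≠ 0) (hρ : ∀ ζ ∈ ball ζ₀ ρ, 1 - ζ.re ^ 2 - ζ.im ^ 2 ≠ 0)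
    (hΦ : IsInverseDiffeo Φ (wePlane p ζ₀ S) (ball ζ₀ ρ)) :
    IsMinimalGraph (fun q => weHeight c ζ₀ S (Φ q)) Φ.source := by
  have hball : ∀ q ∈ Φ.source, Φ q ∈ ball ζ₀ ρ := fun q hq => hΦ.mem_of_mem_source hq
  have hinv : ∀ q ∈ Φ.source, ∀ v, wePlaneDeriv (Φ q) (S (Φ q)) (fderiv ℝ Φ q v) = v :=
    fun q hq => hΦ.deriv_apply_deriv hq (hasFDerivAt_wePlane hS (hball q hq))
  have hz : ∀ q ∈ Φ.source, ∀ v, fderiv ℝ (fun q => weHeight c ζ₀ S (Φ q)) q v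
      = slopeX (Φ q) * v.1 + slopeY (Φ q) * v.2 := by
    intro q hq v
    have h1 := (hasFDerivAt_weHeight (c := c) hS (hball q hq)).comp q (hΦ.hasFDerivAt hq)
    have h2 : fderiv ℝ (fun q => weHeight c ζ₀ S (Φ q)) q = _ := h1.fderiv
    rw [h2, ContinuousLinearMap.comp_apply, reMul_apply,
      ← slopeX_mul_re_add_slopeY_mul_re (hρ _ (hball q hq))]
    conv_rhs => rw [← hinv q hq v]
    rfl
  have hdx : ∀ q ∈ Φ.source, dx (fun q => weHeight c ζ₀ S (Φ q)) q = slopeX (Φ q) := by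
    intro q hq; simp [dx, hz q hq]
  have hdy : ∀ q ∈ Φ.source, dy (fun q => weHeight c ζ₀ S (Φ q)) q = slopeY (Φ q) := by
    intro q hq; simp [dy, hz q hq]
  constructor
  · exact ((contDiffOn_weHeight hS).comp hΦ.smooth hball).of_le (by norm_cast)
  · intro q hq
    have hnhds := Φ.open_source.mem_nhds hq
    have hx : fderiv ℝ (dx fun q => weHeight c ζ₀ S (Φ q)) q = _ :=
      (((hasFDerivAt_slopeX (hρ _ (hball q hq))).comp q (hΦ.hasFDerivAt hq)).congr_of_eventuallyEq
        (by filter_upwards [hnhds] with q' hq' using hdx q' hq')).fderiv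
    have hy : fderiv ℝ (dy fun q => weHeight c ζ₀ S (Φ q)) q = _ :=
      (((hasFDerivAt_slopeY (hρ _ (hball q hq))).comp q (hΦ.hasFDerivAt hq)).congr_of_eventuallyEq
        (by filter_upwards [hnhds] with q' hq' using hdy q' hq')).fderiv
    have key := slope_equation (hρ _ (hball q hq)) (hS0 _ (hball q hq)) (hinv q hq (1, 0))
      (hinv q hq (0, 1))
    rw [hdx q hq, hdy q hq, dx, dx, dy, hx, hy]
    simpa using key

/-- The form "for all small `ρ`" lets `R` and finitely many summands share one disc. -/
lemma eventually_exists_isInverseDiffeo {p : ℝ × ℝ} {ζ₀ : ℂ} {r : ℝ} {S : ℂ → ℂ} (hr : 0 < r)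
    (hS : DifferentiableOn ℂ S (ball ζ₀ r)) (hS0 : ∀ ζ ∈ ball ζ₀ r, S ζ ≠ 0)
    (h : ∀ ζ ∈ ball ζ₀ r, 1 - ζ.re ^ 2 - ζ.im ^ 2 ≠ 0) :
    ∀ᶠ ρ in 𝓝[>] (0 : ℝ), ∃ Φ : OpenPartialHomeomorph (ℝ × ℝ) ℂ,
      IsInverseDiffeo Φ (wePlane p ζ₀ S) (ball ζ₀ ρ) := by
  obtain ⟨ρ₀, hρ₀, H⟩ := exists_isInverseDiffeo hr (contDiffOn_wePlane (p := p) hS)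
    (fun ζ hζ => hasFDerivAt_wePlane hS hζ) (fun ζ hζ => wePlaneDeriv_injective (h ζ hζ) (hS0 ζ hζ))
  filter_upwards [Ioc_mem_nhdsGT hρ₀] with ρ hρ using H ρ hρ.2

/-! ### Decompositions and their non-uniqueness -/

section decomposition

variable {u : ℝ × ℝ → ℝ} {U : Set (ℝ × ℝ)} {p : ℝ × ℝ} {ζ₀ : ℂ} {r : ℝ} {R : ℂ → ℂ} {n : ℕ}
  {S : Fin n → ℂ → ℂ}

/-- All summands are read in the parameter `Φ₀` of the original graph, where heights add by
linearity of the integral. Each is minimal only in its own planar coordinates, through `Φ i`. -/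
theorem exists_isDecomposition (hU : IsOpen U) (hu : DifferentiableOn ℝ u U)
    (hR : IsWERepresentation u U p ζ₀ r R) (hS : IsSplitting ζ₀ r R S) {c : Fin n → ℝ}
    (hc : ∑ i, c i = u p) :
    ∃ (U' : Set (ℝ × ℝ)) (z : Fin n → ℝ × ℝ → ℝ), IsDecomposition u U p ζ₀ r R S c U' z := by
  have hne : ∀ ζ ∈ ball ζ₀ r, 1 - ζ.re ^ 2 - ζ.im ^ 2 ≠ 0 := fun ζ hζ =>
    hR.one_sub_ne_zero hu hU hζ
  have h₀ := eventually_exists_isInverseDiffeo (p := p) hR.pos hR.holomorphic hR.ne_zero hne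
  have hi : ∀ᶠ ρ in 𝓝[>] (0 : ℝ), ∀ i, ∃ Φ : OpenPartialHomeomorph (ℝ × ℝ) ℂ,
      IsInverseDiffeo Φ (wePlane p ζ₀ (S i)) (ball ζ₀ ρ) :=
    eventually_all.mpr fun i =>
      eventually_exists_isInverseDiffeo hR.pos (hS.holomorphic i) (hS.ne_zero i) hne
  obtain ⟨ρ, ⟨Φ₀, hΦ₀⟩, hΦ, hρ⟩ := (h₀.and (hi.and (Ioc_mem_nhdsGT hR.pos))).exists
  choose Φ hΦ using hΦ
  have hsub : ball ζ₀ ρ ⊆ ball ζ₀ r := ball_subset_ball hρ.2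
  have hmem : ∀ q ∈ Φ₀.source, Φ₀ q ∈ ball ζ₀ r := fun q hq => hsub (hΦ₀.mem_of_mem_source hq)
  refine ⟨Φ₀.source, fun i q => weHeight (c i) ζ₀ (S i) (Φ₀ q), Φ₀.open_source, ?_, ?_, ?_,
    ρ, Φ₀, Φ, hρ.1, hρ.2, rfl, hΦ₀, fun i q _ => rfl, hΦ, fun i => ?_⟩
  · simpa using hΦ₀.map_mem_source (mem_ball_self hρ.1)
  · intro q hq
    rw [← hΦ₀.right_inv hq]
    exact hR.mem _ (hmem q hq)
  · intro q hq
    conv_lhs => rw [← hΦ₀.right_inv hq]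
    rw [hR.height _ (hmem q hq)]
    simp only [weHeight, Finset.sum_add_distrib, hc]
    rw [segIntegral_sum Finset.univ (f := fun i w => 2 * w * S i w)
      (fun i _ => (differentiableOn_weZ (hS.holomorphic i)).continuousOn)
      (fun ζ hζ => by rw [hS.sum_eq ζ hζ, Finset.mul_sum]) (hmem q hq), Complex.re_sum]
  · exact isMinimalGraph_weHeight_comp ((hS.holomorphic i).mono hsub)
      (fun ζ hζ => hS.ne_zero i ζ (hsub hζ)) (fun ζ hζ => hne ζ (hsub hζ)) (hΦ i)

lemma isSplitting_const_mul (hR : IsWERepresentation u U p ζ₀ r R) {w : Fin n → ℂ}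
    (hw : ∀ i, w i ≠ 0) (hsum : ∑ i, w i = 1) :
    IsSplitting ζ₀ r R (fun i ζ => w i * R ζ) where
  holomorphic i := hR.holomorphic.const_mul (w i)
  ne_zero i ζ hζ := mul_ne_zero (hw i) (hR.ne_zero ζ hζ)
  sum_eq ζ _ := by rw [← Finset.sum_mul, hsum, one_mul]

lemma IsDecomposition.eventually_eq_weHeight {c : Fin n → ℝ} {U' : Set (ℝ × ℝ)}
    {z : Fin n → ℝ × ℝ → ℝ} (h : IsDecomposition u U p ζ₀ r R S c U' z) (i : Fin n) :
    ∀ᶠ ζ in 𝓝 ζ₀, z i (wePlane p ζ₀ R ζ) = weHeight (c i) ζ₀ (S i) ζ := by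
  obtain ⟨ρ, Φ₀, Φ, hρ, hρr, hsrc, hΦ₀, hz, -⟩ := h.coordinates
  filter_upwards [ball_mem_nhds ζ₀ hρ] with ζ hζ
  rw [hz i _ (hsrc ▸ hΦ₀.map_mem_source hζ), hΦ₀.left_inv hζ]

/-- Differentiating in the directions `1` and `i` recovers `ζ f ζ = ζ g ζ`. Since `ζ₀` may be `0`,
the factor is cancelled only on a punctured neighbourhood and the equality extends to `ζ₀` by
continuity. -/
lemma eq_of_eventually_weHeight_eq_add {f g : ℂ → ℂ} {c d k : ℝ} (hr : 0 < r)
    (hf : DifferentiableOn ℂ f (ball ζ₀ r)) (hg : DifferentiableOn ℂ g (ball ζ₀ r))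
    (h : ∀ᶠ ζ in 𝓝 ζ₀, weHeight c ζ₀ f ζ = weHeight d ζ₀ g ζ + k) : f ζ₀ = g ζ₀ := by
  have h1 : ∀ᶠ ζ in 𝓝 ζ₀, ζ * f ζ = ζ * g ζ := by
    filter_upwards [h.eventually_nhds, ball_mem_nhds ζ₀ hr] with ζ hζ hmem
    have heq := (hasFDerivAt_weHeight (c := c) hf hmem).unique
      (((hasFDerivAt_weHeight (c := d) hg hmem).add_const k).congr_of_eventuallyEq hζ)
    have e1 := DFunLike.congr_fun heq 1
    have e2 := DFunLike.congr_fun heq Complex.I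
    simp only [reMul_apply, mul_assoc] at e1 e2
    apply Complex.ext
    · simpa using e1
    · simp at e2 ⊢
      linear_combination -e2
  have h2 : ∀ᶠ ζ in 𝓝[≠] ζ₀, f ζ = g ζ := by
    have h0 : ∀ᶠ ζ in 𝓝[≠] ζ₀, ζ ≠ 0 := by
      rcases eq_or_ne ζ₀ 0 with rfl | hne
      · exact self_mem_nhdsWithin
      · exact (eventually_ne_nhds hne).filter_mono nhdsWithin_le_nhds
    filter_upwards [h0, h1.filter_mono nhdsWithin_le_nhds] with ζ hζ he
    exact mul_left_cancel₀ hζ he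
  have hcont : ∀ {F : ℂ → ℂ}, DifferentiableOn ℂ F (ball ζ₀ r) →
      Tendsto F (𝓝[≠] ζ₀) (𝓝 (F ζ₀)) := fun hF =>
    ((hF.differentiableAt (ball_mem_nhds ζ₀ hr)).continuousAt).mono_left nhdsWithin_le_nhds
  exact tendsto_nhds_unique_of_eventuallyEq (hcont hf) (hcont hg) h2

/-- Both decompositions pull back along the same map `wePlane p ζ₀ R`, whatever their
neighbourhoods, so matching summands can be compared in `ζ`. -/
lemma EssentiallyEqual.exists_eq {S' : Fin n → ℂ → ℂ} {c c' : Fin n → ℝ} {U' U'' : Set (ℝ × ℝ)}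
    {z z' : Fin n → ℝ × ℝ → ℝ} (he : EssentiallyEqual p z z')
    (hR : IsWERepresentation u U p ζ₀ r R) (hS : IsSplitting ζ₀ r R S)
    (hS' : IsSplitting ζ₀ r R S') (hz : IsDecomposition u U p ζ₀ r R S c U' z)
    (hz' : IsDecomposition u U p ζ₀ r R S' c' U'' z') (i : Fin n) :
    ∃ j, S' i ζ₀ = S j ζ₀ := by
  obtain ⟨σ, hσ⟩ := he
  obtain ⟨k, hk⟩ := hσ i
  refine ⟨σ i, eq_of_eventually_weHeight_eq_add (c := c' i) (d := c (σ i)) (k := k) hR.pos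
    (hS'.holomorphic i) (hS.holomorphic (σ i)) ?_⟩
  have hcont : Tendsto (wePlane p ζ₀ R) (𝓝 ζ₀) (𝓝 p) := by
    have := (hasFDerivAt_wePlane (p := p) hR.holomorphic (mem_ball_self hR.pos)).continuousAt
    simpa [ContinuousAt] using this
  filter_upwards [hcont.eventually hk, hz.eventually_eq_weHeight (σ i),
    hz'.eventually_eq_weHeight i] with ζ h1 h2 h3
  rw [← h2, ← h3, h1]

lemma exists_weights (hn : 2 ≤ n) {s : Set ℂ} (hs : s.Finite) :
    ∃ w : Fin n → ℂ, (∀ i, w i ≠ 0) ∧ ∑ i, w i = 1 ∧ ∃ i, w i ∉ s := by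
  obtain ⟨m, rfl⟩ : ∃ m, n = m + 2 := ⟨n - 2, by omega⟩
  obtain ⟨lam, hlam⟩ := ((hs.insert 1).insert 0).infinite_compl.nonempty
  simp only [Set.mem_compl_iff, Set.mem_insert_iff, not_or] at hlam
  have hm : (m : ℂ) + 1 ≠ 0 := by exact_mod_cast Nat.succ_ne_zero m
  -- The first weight avoids `s`, `0` and `1`; the other `m + 1` share the remainder equally, which
  -- is nonzero as `lam ≠ 1`.
  refine ⟨Fin.cons lam fun _ => (1 - lam) / (m + 1), ?_, ?_, 0, hlam.2.2⟩
  · intro i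
    refine Fin.cases ?_ (fun j => ?_) i
    · exact hlam.1
    · exact div_ne_zero (sub_ne_zero.mpr (Ne.symm hlam.2.1)) hm
  · rw [Fin.sum_univ_succ]
    simp only [Fin.cons_zero, Fin.cons_succ, Finset.sum_const, Finset.card_univ, Fintype.card_fin,
      nsmul_eq_mul, Nat.cast_add, Nat.cast_one]
    rw [mul_div_cancel₀ _ hm]
    ring

theorem exists_isSplitting (hR : IsWERepresentation u U p ζ₀ r R) (hn : 1 ≤ n) :
    ∃ S : Fin n → ℂ → ℂ, IsSplitting ζ₀ r R S := by
  have hn0 : (n : ℂ) ≠ 0 := by exact_mod_cast (by omega : n ≠ 0)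
  exact ⟨_, isSplitting_const_mul (w := fun _ => (n : ℂ)⁻¹) hR (fun _ => inv_ne_zero hn0)
    (by simp [hn0])⟩

theorem exists_isDecomposition_not_essentiallyEqual (hU : IsOpen U) (hu : DifferentiableOn ℝ u U)
    (hR : IsWERepresentation u U p ζ₀ r R) (hn : 2 ≤ n) (hS : IsSplitting ζ₀ r R S)
    {c : Fin n → ℝ} {U' : Set (ℝ × ℝ)} {z : Fin n → ℝ × ℝ → ℝ}
    (hz : IsDecomposition u U p ζ₀ r R S c U' z) :
    ∃ (S' : Fin n → ℂ → ℂ) (c' : Fin n → ℝ) (U'' : Set (ℝ × ℝ)) (z' : Fin n → ℝ × ℝ → ℝ),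
      IsSplitting ζ₀ r R S' ∧ IsDecomposition u U p ζ₀ r R S' c' U'' z' ∧
        ¬ EssentiallyEqual p z z' := by
  -- Essential equality would force every weight to be one of these finitely many ratios at `ζ₀`.
  obtain ⟨w, hw, hsum, i, hi⟩ :=
    exists_weights hn (Set.finite_range fun j => S j ζ₀ / R ζ₀)
  have hS' := isSplitting_const_mul hR hw hsum
  have hn0 : (n : ℝ) ≠ 0 := by exact_mod_cast (by omega : n ≠ 0)
  obtain ⟨U'', z', hz'⟩ := exists_isDecomposition hU hu hR hS' (c := fun _ => u p / n)
    (by simp; field_simp)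
  refine ⟨_, _, U'', z', hS', hz', fun he => hi ?_⟩
  obtain ⟨j, hj⟩ := he.exists_eq hR hS hS' hz hz' i
  exact ⟨j, by simp only [← hj]; exact mul_div_cancel_right₀ _ (hR.ne_zero _ (mem_ball_self hR.pos))⟩

end decomposition

/-! ### Second derivatives and the Hessian -/

section SecondDerivatives

variable {u : ℝ × ℝ → ℝ} {U : Set (ℝ × ℝ)} {q : ℝ × ℝ}

lemma contDiffOn_dx (hu : ContDiffOn ℝ 2 u U) (hU : IsOpen U) : ContDiffOn ℝ 1 (dx u) U :=
  (hu.fderiv_of_isOpen hU (by norm_num)).clm_apply contDiffOn_const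

lemma contDiffOn_dy (hu : ContDiffOn ℝ 2 u U) (hU : IsOpen U) : ContDiffOn ℝ 1 (dy u) U :=
  (hu.fderiv_of_isOpen hU (by norm_num)).clm_apply contDiffOn_const

lemma dy_dx_eq_dx_dy (hu : ContDiffAt ℝ 2 u q) : dy (dx u) q = dx (dy u) q := by
  have hd : DifferentiableAt ℝ (fderiv ℝ u) q :=
    (hu.fderiv_right (m := 1) (by norm_num)).differentiableAt (by norm_num)
  have h (v w : ℝ × ℝ) : fderiv ℝ (fun q => fderiv ℝ u q v) q w = fderiv ℝ (fderiv ℝ u) q w v := by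
    rw [fderiv_clm_apply hd (differentiableAt_const v)]
    simp
  have hs := hu.isSymmSndFDerivAt (by simp)
  change fderiv ℝ (fun q => fderiv ℝ u q (1, 0)) q (0, 1)
    = fderiv ℝ (fun q => fderiv ℝ u q (0, 1)) q (1, 0)
  rw [h, h]
  exact hs.eq _ _

lemma hasFDerivAt_dx (hu : ContDiffOn ℝ 2 u U) (hU : IsOpen U) (hq : q ∈ U) :
    HasFDerivAt (dx u) (dx (dx u) q • ContinuousLinearMap.fst ℝ ℝ ℝ
      + dx (dy u) q • ContinuousLinearMap.snd ℝ ℝ ℝ) q := by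
  have h := (((contDiffOn_dx hu hU).differentiableOn (by norm_num)).differentiableAt
    (hU.mem_nhds hq)).hasFDerivAt
  refine h.congr_fderiv (ContinuousLinearMap.ext fun v => ?_)
  rw [clm_prod_apply, ← dy_dx_eq_dx_dy (hu.contDiffAt (hU.mem_nhds hq))]
  rfl

lemma hasFDerivAt_dy (hu : ContDiffOn ℝ 2 u U) (hU : IsOpen U) (hq : q ∈ U) :
    HasFDerivAt (dy u) (dx (dy u) q • ContinuousLinearMap.fst ℝ ℝ ℝ
      + dy (dy u) q • ContinuousLinearMap.snd ℝ ℝ ℝ) q := by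
  have h := (((contDiffOn_dy hu hU).differentiableOn (by norm_num)).differentiableAt
    (hU.mem_nhds hq)).hasFDerivAt
  refine h.congr_fderiv (ContinuousLinearMap.ext fun v => ?_)
  rw [clm_prod_apply]
  rfl

/-- At a non-umbilical point of a minimal graph, the Hessian is non-degenerate. -/
lemma IsMinimalGraph.hessian_det_ne_zero (hu : IsMinimalGraph u U) (hq : q ∈ U)
    (hnu : ¬ IsUmbilic u q) :
    dx (dx u) q * dy (dy u) q - dx (dy u) q ^ 2 ≠ 0 := by
  intro hD
  have heq := hu.equation q hq
  apply hnu
  generalize hr : dx (dx u) q = r at *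
  generalize hs : dx (dy u) q = s at *
  generalize ht : dy (dy u) q = t at *
  have hE : 0 < 1 + dx u q ^ 2 := by positivity
  have hG : 0 < 1 + dy u q ^ 2 := by positivity
  -- With `E`, `F`, `G` the first fundamental form, multiply the equation by `E t` and put `r t =
  -- s²`: the result is `(E t - F s)² + (E G - F²) s² = 0`, with `E G - F² = 1 + u_x² + u_y²`. Hence
  -- all second derivatives vanish and the point is umbilical with `κ = 0`.
  have hsq : ((1 + dx u q ^ 2) * t - dx u q * dy u q * s) ^ 2
      + (1 + dx u q ^ 2 + dy u q ^ 2) * s ^ 2 = 0 := by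
    linear_combination (1 + dx u q ^ 2) * t * heq
      - (1 + dx u q ^ 2) * (1 + dy u q ^ 2) * hD
  have hs0 : s = 0 := by
    have h1 : 0 ≤ ((1 + dx u q ^ 2) * t - dx u q * dy u q * s) ^ 2 := sq_nonneg _
    have h2 : s ^ 2 ≤ 0 := by nlinarith [sq_nonneg (dx u q * s), sq_nonneg (dy u q * s)]
    exact pow_eq_zero_iff (two_ne_zero) |>.mp (le_antisymm h2 (sq_nonneg s))
  subst hs0
  have ht0 : t = 0 := by
    have h3 : ((1 + dx u q ^ 2) * t) ^ 2 = 0 := by linear_combination hsq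
    exact (mul_eq_zero.mp (pow_eq_zero_iff (two_ne_zero) |>.mp h3)).resolve_left hE.ne'
  subst ht0
  have hr0 : r = 0 := by
    have h4 : (1 + dy u q ^ 2) * r = 0 := by linear_combination heq
    exact (mul_eq_zero.mp h4).resolve_left hG.ne'
  subst hr0
  exact ⟨0, by simp [hr, hs, ht]⟩

end SecondDerivatives

/-! ### The Gauss map as a local coordinate -/

section GaussMap

variable (u : ℝ × ℝ → ℝ) (q : ℝ × ℝ)

/-- The stereographic projection of the unit normal of the graph. -/
def gaussMap : ℂ :=
  Complex.equivRealProdCLM.symm (dx u q / (1 + areaDensity u q), dy u q / (1 + areaDensity u q))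

lemma areaDensity_sq : areaDensity u q ^ 2 = 1 + dx u q ^ 2 + dy u q ^ 2 :=
  Real.sq_sqrt (by positivity)

lemma areaDensity_pos : 0 < areaDensity u q := Real.sqrt_pos.mpr (by positivity)

@[simp] lemma gaussMap_re : (gaussMap u q).re = dx u q / (1 + areaDensity u q) := rfl

@[simp] lemma gaussMap_im : (gaussMap u q).im = dy u q / (1 + areaDensity u q) := rfl

lemma one_sub_gaussMap :
    1 - (gaussMap u q).re ^ 2 - (gaussMap u q).im ^ 2 = 2 / (1 + areaDensity u q) := by
  have h := areaDensity_sq u q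
  have h0 : 1 + areaDensity u q ≠ 0 := by have := areaDensity_pos u q; positivity
  simp only [gaussMap_re, gaussMap_im]
  field_simp
  linear_combination h

lemma one_sub_gaussMap_pos : 0 < 1 - (gaussMap u q).re ^ 2 - (gaussMap u q).im ^ 2 := by
  have := areaDensity_pos u q
  rw [one_sub_gaussMap]
  positivity

/-- The slope functions undo the stereographic projection, so the Gauss map is the
Weierstrass–Enneper parameter of the graph. -/
lemma slopeX_gaussMap : slopeX (gaussMap u q) = dx u q := by
  have h0 : 1 + areaDensity u q ≠ 0 := by have := areaDensity_pos u q; positivity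
  rw [slopeX, one_sub_gaussMap, gaussMap_re]
  field_simp

lemma slopeY_gaussMap : slopeY (gaussMap u q) = dy u q := by
  have h0 : 1 + areaDensity u q ≠ 0 := by have := areaDensity_pos u q; positivity
  rw [slopeY, one_sub_gaussMap, gaussMap_im]
  field_simp

lemma areaDensity_eq_gaussMap :
    areaDensity u q = (1 + (gaussMap u q).re ^ 2 + (gaussMap u q).im ^ 2)
      / (1 - (gaussMap u q).re ^ 2 - (gaussMap u q).im ^ 2) := by
  have h0 : 1 + areaDensity u q ≠ 0 := by have := areaDensity_pos u q; positivity
  have h := one_sub_gaussMap u q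
  have h1 : 1 + (gaussMap u q).re ^ 2 + (gaussMap u q).im ^ 2 = 2 - 2 / (1 + areaDensity u q) := by
    linear_combination -h
  rw [h, h1]
  field_simp
  ring

variable {u q} {U : Set (ℝ × ℝ)}

lemma contDiffOn_areaDensity (hu : ContDiffOn ℝ 2 u U) (hU : IsOpen U) :
    ContDiffOn ℝ 1 (areaDensity u) U :=
  ((contDiffOn_const.add ((contDiffOn_dx hu hU).pow 2)).add ((contDiffOn_dy hu hU).pow 2)).sqrt
    fun q _ => by positivity

lemma contDiffOn_gaussMap (hu : ContDiffOn ℝ 2 u U) (hU : IsOpen U) :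
    ContDiffOn ℝ 1 (gaussMap u) U := by
  have hW := contDiffOn_const (c := (1 : ℝ)).add (contDiffOn_areaDensity hu hU)
  have h0 : ∀ q ∈ U, 1 + areaDensity u q ≠ 0 := fun q _ => by
    have := areaDensity_pos u q; positivity
  exact (Complex.equivRealProdCLM.symm.contDiff (n := 1)).comp_contDiffOn
    (((contDiffOn_dx hu hU).div hW h0).prodMk ((contDiffOn_dy hu hU).div hW h0))

/-- The gradient of `u` factors through the Gauss map, so a kernel vector of `g'` is also killed by
the Hessian. -/
lemma IsMinimalGraph.injective_of_hasFDerivAt_gaussMap (hu : IsMinimalGraph u U) (hU : IsOpen U)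
    (hq : q ∈ U) (hnu : ¬ IsUmbilic u q) {g' : ℝ × ℝ →L[ℝ] ℂ}
    (hg : HasFDerivAt (gaussMap u) g' q) : Function.Injective g' := by
  rw [injective_iff_map_eq_zero]
  intro v hv
  have hne := (one_sub_gaussMap_pos u q).ne'
  have hx := ((hasFDerivAt_slopeX hne).comp q hg).congr_of_eventuallyEq
    (Eventually.of_forall fun q => (slopeX_gaussMap u q).symm)
  have hy := ((hasFDerivAt_slopeY hne).comp q hg).congr_of_eventuallyEq
    (Eventually.of_forall fun q => (slopeY_gaussMap u q).symm)
  have ex := DFunLike.congr_fun (hx.unique (hasFDerivAt_dx hu.contDiffOn hU hq)) v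
  have ey := DFunLike.congr_fun (hy.unique (hasFDerivAt_dy hu.contDiffOn hU hq)) v
  simp [hv] at ex ey
  have hD := hu.hessian_det_ne_zero hq hnu
  ext
  · refine (mul_eq_zero.mp ?_).resolve_left hD
    linear_combination dx (dy u) q * ey - dy (dy u) q * ex
  · refine (mul_eq_zero.mp ?_).resolve_left hD
    linear_combination dx (dy u) q * ex - dx (dx u) q * ey

end GaussMap

/-! ### Conjugate functions of the coordinates -/

section ConjugateFunctions

/-- The Poincaré lemma for `A dx + B dy`, with `h` as closedness. -/
lemma exists_hasFDerivAt_of_closed {s : Set (ℝ × ℝ)} (hs : Convex ℝ s) (hso : IsOpen s)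
    {A B : ℝ × ℝ → ℝ} {A' B' : ℝ × ℝ → ℝ × ℝ →L[ℝ] ℝ} (hA : ∀ q ∈ s, HasFDerivAt A (A' q) q)
    (hB : ∀ q ∈ s, HasFDerivAt B (B' q) q) (h : ∀ q ∈ s, A' q (0, 1) = B' q (1, 0)) :
    ∃ f : ℝ × ℝ → ℝ, ∀ q ∈ s, HasFDerivAt f
      (A q • ContinuousLinearMap.fst ℝ ℝ ℝ + B q • ContinuousLinearMap.snd ℝ ℝ ℝ) q := by
  have hω : ∀ q ∈ s, HasFDerivAt (fun q => A q • ContinuousLinearMap.fst ℝ ℝ ℝ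
      + B q • ContinuousLinearMap.snd ℝ ℝ ℝ) ((A' q).smulRight (ContinuousLinearMap.fst ℝ ℝ ℝ)
      + (B' q).smulRight (ContinuousLinearMap.snd ℝ ℝ ℝ)) q := fun q hq =>
    ((hA q hq).smul_const (ContinuousLinearMap.fst ℝ ℝ ℝ)).add
      ((hB q hq).smul_const (ContinuousLinearMap.snd ℝ ℝ ℝ))
  refine hs.exists_forall_hasFDerivAt_of_fderiv_symmetric hso
    (fun q hq => (hω q hq).differentiableAt.differentiableWithinAt) fun q hq v w => ?_
  rw [(hω q hq).fderiv]
  simp only [add_apply, ContinuousLinearMap.smulRight_apply,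
    smul_apply, ContinuousLinearMap.coe_fst', ContinuousLinearMap.coe_snd',
    smul_eq_mul]
  rw [clm_prod_apply (A' q) v, clm_prod_apply (A' q) w, clm_prod_apply (B' q) v,
    clm_prod_apply (B' q) w, h q hq]
  ring

variable {u : ℝ × ℝ → ℝ} {U : Set (ℝ × ℝ)} {q : ℝ × ℝ}

lemma hasFDerivAt_areaDensity (hu : ContDiffOn ℝ 2 u U) (hU : IsOpen U) (hq : q ∈ U) :
    HasFDerivAt (areaDensity u)
      (((dx u q * dx (dx u) q + dy u q * dx (dy u) q) / areaDensity u q) •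
          ContinuousLinearMap.fst ℝ ℝ ℝ
        + ((dx u q * dx (dy u) q + dy u q * dy (dy u) q) / areaDensity u q) •
          ContinuousLinearMap.snd ℝ ℝ ℝ) q := by
  have hx := hasFDerivAt_dx hu hU hq
  have hy := hasFDerivAt_dy hu hU hq
  have h0 : 1 + dx u q ^ 2 + dy u q ^ 2 ≠ 0 := by positivity
  have h := (((hx.pow 2).const_add 1).add (hy.pow 2)).sqrt h0
  refine HasFDerivAt.congr_fderiv (f := areaDensity u) h (ContinuousLinearMap.ext fun v => ?_)
  have hW : √(1 + dx u q ^ 2 + dy u q ^ 2) = areaDensity u q := rfl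
  have := (areaDensity_pos u q).ne'
  simp [hW]
  field_simp
  ring

/-- The conjugate function of `y` on a minimal graph. -/
lemma IsMinimalGraph.exists_conjugate_snd (hu : IsMinimalGraph u U) (hU : IsOpen U)
    {s : Set (ℝ × ℝ)} (hs : Convex ℝ s) (hso : IsOpen s) (hsU : s ⊆ U) :
    ∃ f : ℝ × ℝ → ℝ, ∀ q ∈ s, HasFDerivAt f
      (((1 + dx u q ^ 2) / areaDensity u q) • ContinuousLinearMap.fst ℝ ℝ ℝ
        + (dx u q * dy u q / areaDensity u q) • ContinuousLinearMap.snd ℝ ℝ ℝ) q := by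
  have hx := fun q (hq : q ∈ s) => hasFDerivAt_dx hu.contDiffOn hU (hsU hq)
  have hy := fun q (hq : q ∈ s) => hasFDerivAt_dy hu.contDiffOn hU (hsU hq)
  have hW := fun q (hq : q ∈ s) => hasFDerivAt_areaDensity hu.contDiffOn hU (hsU hq)
  refine exists_hasFDerivAt_of_closed hs hso
    (A := fun q => (1 + dx u q ^ 2) / areaDensity u q)
    (B := fun q => dx u q * dy u q / areaDensity u q)
    (fun q hq => hasFDerivAt_div (((hx q hq).pow 2).const_add 1) (hW q hq) (areaDensity_pos u q).ne')
    (fun q hq => hasFDerivAt_div ((hx q hq).mul (hy q hq)) (hW q hq) (areaDensity_pos u q).ne')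
    fun q hq => ?_
  have hpos := (areaDensity_pos u q).ne'
  have hsq := areaDensity_sq u q
  have heq := hu.equation q (hsU hq)
  simp
  field_simp
  rw [hsq]
  -- With denominators cleared, closedness is a multiple of the minimal surface equation.
  linear_combination (-dy u q) * heq

/-- The conjugate function of `x` on a minimal graph. -/
lemma IsMinimalGraph.exists_conjugate_fst (hu : IsMinimalGraph u U) (hU : IsOpen U)
    {s : Set (ℝ × ℝ)} (hs : Convex ℝ s) (hso : IsOpen s) (hsU : s ⊆ U) :
    ∃ f : ℝ × ℝ → ℝ, ∀ q ∈ s, HasFDerivAt f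
      ((-(dx u q * dy u q) / areaDensity u q) • ContinuousLinearMap.fst ℝ ℝ ℝ
        + (-(1 + dy u q ^ 2) / areaDensity u q) • ContinuousLinearMap.snd ℝ ℝ ℝ) q := by
  have hx := fun q (hq : q ∈ s) => hasFDerivAt_dx hu.contDiffOn hU (hsU hq)
  have hy := fun q (hq : q ∈ s) => hasFDerivAt_dy hu.contDiffOn hU (hsU hq)
  have hW := fun q (hq : q ∈ s) => hasFDerivAt_areaDensity hu.contDiffOn hU (hsU hq)
  refine exists_hasFDerivAt_of_closed hs hso
    (A := fun q => -(dx u q * dy u q) / areaDensity u q)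
    (B := fun q => -(1 + dy u q ^ 2) / areaDensity u q)
    (fun q hq => hasFDerivAt_div ((hx q hq).mul (hy q hq)).neg (hW q hq) (areaDensity_pos u q).ne')
    (fun q hq => hasFDerivAt_div (((hy q hq).pow 2).const_add 1).neg (hW q hq)
      (areaDensity_pos u q).ne')
    fun q hq => ?_
  have hpos := (areaDensity_pos u q).ne'
  have hsq := areaDensity_sq u q
  have heq := hu.equation q (hsU hq)
  simp
  field_simp
  rw [hsq]
  linear_combination (-dx u q) * heq

end ConjugateFunctions

/-! ### Existence of a Weierstrass–Enneper function -/

/-- The Cauchy–Riemann equations between the coordinates of a minimal graph and their conjugate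
functions, in the parameter given by the Gauss map. -/
lemma conjugate_relations {a b r s t xa xb ya yb : ℝ} (hK : 1 - a ^ 2 - b ^ 2 ≠ 0)
    {P Q W : ℝ} (hP : P = 2 * a / (1 - a ^ 2 - b ^ 2)) (hQ : Q = 2 * b / (1 - a ^ 2 - b ^ 2))
    (hW : W = (1 + a ^ 2 + b ^ 2) / (1 - a ^ 2 - b ^ 2))
    (h1 : 2 * (1 + a ^ 2 - b ^ 2) / (1 - a ^ 2 - b ^ 2) ^ 2 = r * xa + s * ya)
    (h2 : 4 * a * b / (1 - a ^ 2 - b ^ 2) ^ 2 = r * xb + s * yb)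
    (h3 : 4 * a * b / (1 - a ^ 2 - b ^ 2) ^ 2 = s * xa + t * ya)
    (h4 : 2 * (1 - a ^ 2 + b ^ 2) / (1 - a ^ 2 - b ^ 2) ^ 2 = s * xb + t * yb)
    (heq : (1 + P ^ 2) * t - 2 * P * Q * s + (1 + Q ^ 2) * r = 0) :
    P * Q * xa + (1 + Q ^ 2) * ya = W * xb ∧ P * Q * xb + (1 + Q ^ 2) * yb = -(W * xa) ∧
      (1 + P ^ 2) * xa + P * Q * ya = -(W * yb) ∧ (1 + P ^ 2) * xb + P * Q * yb = W * ya ∧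
      xa * yb - xb * ya ≠ 0 := by
  set A := 2 * (1 + a ^ 2 - b ^ 2) / (1 - a ^ 2 - b ^ 2) ^ 2 with hA
  set B := 4 * a * b / (1 - a ^ 2 - b ^ 2) ^ 2 with hB
  set C := 2 * (1 - a ^ 2 + b ^ 2) / (1 - a ^ 2 - b ^ 2) ^ 2 with hC
  have i1 : P * Q * A - (1 + P ^ 2) * B - W * B = 0 := by
    rw [hP, hQ, hW, hA, hB]; field_simp; ring
  have i2 : P * Q * B - (1 + Q ^ 2) * A + W * C = 0 := by
    rw [hP, hQ, hW, hA, hB, hC]; field_simp; ring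
  have i3 : P * Q * B - (1 + P ^ 2) * C + W * A = 0 := by
    rw [hP, hQ, hW, hA, hB, hC]; field_simp; ring
  have i4 : P * Q * C - (1 + Q ^ 2) * B - W * B = 0 := by
    rw [hP, hQ, hW, hB, hC]; field_simp; ring
  have hJ : A * C - B * B ≠ 0 := by
    have hpos : 1 + a ^ 2 + b ^ 2 ≠ 0 := by positivity
    have : A * C - B * B = 4 * (1 + a ^ 2 + b ^ 2) / (1 - a ^ 2 - b ^ 2) ^ 3 := by
      rw [hA, hB, hC]; field_simp; ring
    rw [this]
    exact div_ne_zero (mul_ne_zero four_ne_zero hpos) (pow_ne_zero 3 hK)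
  -- Chain rule for determinants: the Jacobian of the slopes in `ζ` is the Hessian of `u` times the
  -- Jacobian of `ζ ↦ (x, y)`. The left factor is nonzero, so both others are; `e1`–`e4` are
  -- Cramer's rule.
  have hdet : (r * t - s ^ 2) * (xa * yb - xb * ya) = A * C - B * B := by
    rw [h1, h4]
    nth_rw 1 [h2]
    rw [h3]
    ring
  rw [← hdet] at hJ
  have hD := left_ne_zero_of_mul hJ
  have e1 : (r * t - s ^ 2) * xa = t * A - s * B := by linear_combination s * h3 - t * h1
  have e2 : (r * t - s ^ 2) * ya = r * B - s * A := by linear_combination s * h1 - r * h3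
  have e3 : (r * t - s ^ 2) * xb = t * B - s * C := by linear_combination s * h4 - t * h2
  have e4 : (r * t - s ^ 2) * yb = r * C - s * B := by linear_combination s * h2 - r * h4
  refine ⟨mul_left_cancel₀ hD ?_, mul_left_cancel₀ hD ?_, mul_left_cancel₀ hD ?_,
    mul_left_cancel₀ hD ?_, right_ne_zero_of_mul hJ⟩
  · linear_combination P * Q * e1 + (1 + Q ^ 2) * e2 - W * e3 + B * heq + t * i1 + s * i2
  · linear_combination P * Q * e3 + (1 + Q ^ 2) * e4 + W * e1 + C * heq + t * i3 + s * i4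
  · linear_combination (1 + P ^ 2) * e1 + P * Q * e2 + W * e4 + A * heq + r * i2 + s * i1
  · linear_combination (1 + P ^ 2) * e3 + P * Q * e4 - W * e2 + B * heq + r * i4 + s * i3

/-- The two relations determine the derivatives of `y` from those of `x`. The resulting
proportionality lets a single `R` serve both planar coordinates. -/
lemma we_proportional {a b xa xb ya yb P Q W : ℝ} (hK : 1 - a ^ 2 - b ^ 2 ≠ 0)
    (hP : P = 2 * a / (1 - a ^ 2 - b ^ 2)) (hQ : Q = 2 * b / (1 - a ^ 2 - b ^ 2))
    (hW : W = (1 + a ^ 2 + b ^ 2) / (1 - a ^ 2 - b ^ 2))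
    (h1 : P * Q * xa + (1 + Q ^ 2) * ya = W * xb)
    (h2 : P * Q * xb + (1 + Q ^ 2) * yb = -(W * xa)) {ζ μ ν : ℂ} (hζ : ζ = ⟨a, b⟩)
    (hμ : μ = ⟨xa, -xb⟩) (hν : ν = ⟨ya, -yb⟩) :
    (1 - ζ ^ 2) * ν = Complex.I * (1 + ζ ^ 2) * μ := by
  subst hζ hμ hν
  have hG : 1 + Q ^ 2 ≠ 0 := by positivity
  have hya : ya = (W * xb - P * Q * xa) / (1 + Q ^ 2) := by
    rw [eq_div_iff hG]; linear_combination h1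
  have hyb : yb = (-(W * xa) - P * Q * xb) / (1 + Q ^ 2) := by
    rw [eq_div_iff hG]; linear_combination h2
  have k1 : (1 - a ^ 2 + b ^ 2) * (P * Q) = 2 * a * b * (1 + Q ^ 2) + 2 * a * b * W := by
    rw [hP, hQ, hW]; field_simp; ring
  have k2 : (1 - a ^ 2 + b ^ 2) * W + 2 * a * b * (P * Q) = (1 + a ^ 2 - b ^ 2) * (1 + Q ^ 2) := by
    rw [hP, hQ, hW]; field_simp; ring
  apply Complex.ext
  · simp [pow_two]
    rw [hya, hyb]
    field_simp
    linear_combination (-xa) * k1 + xb * k2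
  · simp [pow_two]
    rw [hya, hyb]
    field_simp
    linear_combination xb * k1 + xa * k2

lemma hasDerivAt_of_cauchyRiemann {f g : ℂ → ℝ} {f' g' : ℂ →L[ℝ] ℝ} {ζ : ℂ}
    (hf : HasFDerivAt f f' ζ) (hg : HasFDerivAt g g' ζ) (h1 : g' 1 = -f' Complex.I)
    (h2 : g' Complex.I = f' 1) :
    HasDerivAt (fun w => Complex.equivRealProdCLM.symm (f w, g w)) ⟨f' 1, -f' Complex.I⟩ ζ := by
  have h : HasFDerivAt (fun w => Complex.equivRealProdCLM.symm (f w, g w))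
      ((Complex.equivRealProdCLM.symm : ℝ × ℝ →L[ℝ] ℂ).comp (f'.prod g')) ζ :=
    (Complex.equivRealProdCLM.symm : ℝ × ℝ →L[ℝ] ℂ).hasFDerivAt.comp ζ (hf.prodMk hg)
  refine (HasFDerivAt.complexOfReal_hasFDerivAt h ?_).hasDerivAt.congr_deriv ?_
  · apply Complex.ext <;> simp [h1, h2]
  · apply Complex.ext <;> simp [h1]

theorem IsMinimalGraph.exists_isWERepresentation {u : ℝ × ℝ → ℝ} {U : Set (ℝ × ℝ)} {p : ℝ × ℝ}
    (hu : IsMinimalGraph u U) (hU : IsOpen U) (hp : p ∈ U) (hnu : ¬ IsUmbilic u p) :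
    ∃ (ζ₀ : ℂ) (r : ℝ) (R : ℂ → ℂ), IsWERepresentation u U p ζ₀ r R := by
  obtain ⟨ε, hε, hV⟩ := Metric.isOpen_iff.mp hU p hp
  obtain ⟨f, hf⟩ := hu.exists_conjugate_fst hU (convex_ball p ε) isOpen_ball hV
  obtain ⟨g, hg⟩ := hu.exists_conjugate_snd hU (convex_ball p ε) isOpen_ball hV
  have hgauss : ContDiffAt ℝ 1 (gaussMap u) p :=
    (contDiffOn_gaussMap hu.contDiffOn hU).contDiffAt (hU.mem_nhds hp)
  have hgd := (hgauss.differentiableAt one_ne_zero).hasFDerivAt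
  obtain ⟨e, he⟩ := exists_equiv_of_injective (by simp)
    (hu.injective_of_hasFDerivAt_gaussMap hU hp hnu hgd)
  rw [← he] at hgd
  set Θ := hgauss.toOpenPartialHomeomorph (gaussMap u) hgd one_ne_zero with hΘ
  have hpΘ : p ∈ Θ.source := hgauss.mem_toOpenPartialHomeomorph_source hgd one_ne_zero
  set ζ₀ := gaussMap u p with hζ₀
  set X : ℂ → ℝ × ℝ := ⇑Θ.symm with hX
  have hXζ₀ : X ζ₀ = p := Θ.left_inv hpΘ
  have hζ₀t : ζ₀ ∈ Θ.target := Θ.map_source hpΘ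
  have hXc : ContDiffAt ℝ 1 X ζ₀ := hgauss.to_localInverse hgd one_ne_zero
  have hev : ∀ᶠ ζ in 𝓝 ζ₀, ζ ∈ Θ.target ∧ X ζ ∈ ball p ε ∧ DifferentiableAt ℝ X ζ := by
    refine Eventually.and (Θ.open_target.mem_nhds hζ₀t) (Eventually.and ?_ ?_)
    · exact hXc.continuousAt.eventually (hXζ₀.symm ▸ ball_mem_nhds p hε)
    · filter_upwards [hXc.eventually (by simp)] with ζ hζ using hζ.differentiableAt one_ne_zero
  obtain ⟨r, hr, hball⟩ := Metric.eventually_nhds_iff_ball.mp hev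
  have hinv : ∀ ζ ∈ ball ζ₀ r, gaussMap u (X ζ) = ζ := fun ζ hζ => Θ.right_inv (hball ζ hζ).1
  have hXU : ∀ ζ ∈ ball ζ₀ r, X ζ ∈ U := fun ζ hζ => hV (hball ζ hζ).2.1
  have hXd : ∀ ζ ∈ ball ζ₀ r, HasFDerivAt X (fderiv ℝ X ζ) ζ := fun ζ hζ =>
    (hball ζ hζ).2.2.hasFDerivAt
  have hK : ∀ ζ ∈ ball ζ₀ r, 0 < 1 - ζ.re ^ 2 - ζ.im ^ 2 := fun ζ hζ => by
    have := one_sub_gaussMap_pos u (X ζ)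
    rwa [hinv ζ hζ] at this
  have hPX : ∀ ζ ∈ ball ζ₀ r, dx u (X ζ) = slopeX ζ := fun ζ hζ => by
    rw [← slopeX_gaussMap, hinv ζ hζ]
  have hQX : ∀ ζ ∈ ball ζ₀ r, dy u (X ζ) = slopeY ζ := fun ζ hζ => by
    rw [← slopeY_gaussMap, hinv ζ hζ]
  have hWX : ∀ ζ ∈ ball ζ₀ r, areaDensity u (X ζ)
      = (1 + ζ.re ^ 2 + ζ.im ^ 2) / (1 - ζ.re ^ 2 - ζ.im ^ 2) := fun ζ hζ => by
    rw [areaDensity_eq_gaussMap, hinv ζ hζ]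
  have hrel : ∀ ζ ∈ ball ζ₀ r, _ := fun ζ hζ => by
    have hne := (hK ζ hζ).ne'
    have hx := (((hasFDerivAt_dx hu.contDiffOn hU (hXU ζ hζ)).comp ζ (hXd ζ hζ)).unique
      ((hasFDerivAt_slopeX hne).congr_of_eventuallyEq
        (by filter_upwards [isOpen_ball.mem_nhds hζ] with w hw using hPX w hw)))
    have hy := (((hasFDerivAt_dy hu.contDiffOn hU (hXU ζ hζ)).comp ζ (hXd ζ hζ)).unique
      ((hasFDerivAt_slopeY hne).congr_of_eventuallyEq
        (by filter_upwards [isOpen_ball.mem_nhds hζ] with w hw using hQX w hw)))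
    have h1 := (DFunLike.congr_fun hx 1).symm
    have h2 := (DFunLike.congr_fun hx Complex.I).symm
    have h3 := (DFunLike.congr_fun hy 1).symm
    have h4 := (DFunLike.congr_fun hy Complex.I).symm
    simp at h1 h2 h3 h4
    exact conjugate_relations hne (hPX ζ hζ) (hQX ζ hζ) (hWX ζ hζ) h1 h2 h3 h4
      (hu.equation _ (hXU ζ hζ))
  have hfst : ∀ ζ ∈ ball ζ₀ r, HasFDerivAt (fun w => (X w).1)
      ((ContinuousLinearMap.fst ℝ ℝ ℝ).comp (fderiv ℝ X ζ)) ζ := fun ζ hζ => (hXd ζ hζ).fst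
  have hsnd : ∀ ζ ∈ ball ζ₀ r, HasFDerivAt (fun w => (X w).2)
      ((ContinuousLinearMap.snd ℝ ℝ ℝ).comp (fderiv ℝ X ζ)) ζ := fun ζ hζ => (hXd ζ hζ).snd
  set Ξ : ℂ → ℂ := fun w => Complex.equivRealProdCLM.symm ((X w).1, f (X w)) with hΞ
  set Υ : ℂ → ℂ := fun w => Complex.equivRealProdCLM.symm ((X w).2, g (X w)) with hΥ
  set μ : ℂ → ℂ := fun ζ => ⟨(fderiv ℝ X ζ 1).1, -(fderiv ℝ X ζ Complex.I).1⟩ with hμ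
  set ν : ℂ → ℂ := fun ζ => ⟨(fderiv ℝ X ζ 1).2, -(fderiv ℝ X ζ Complex.I).2⟩ with hν
  have hΞd : ∀ ζ ∈ ball ζ₀ r, HasDerivAt Ξ (μ ζ) ζ := fun ζ hζ => by
    obtain ⟨c1, c2, -⟩ := hrel ζ hζ
    have hpos := (areaDensity_pos u (X ζ)).ne'
    refine hasDerivAt_of_cauchyRiemann (hfst ζ hζ)
      ((hf _ (hball ζ hζ).2.1).comp ζ (hXd ζ hζ)) ?_ ?_
    · simp
      field_simp
      linear_combination -c1
    · simp
      field_simp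
      linear_combination -c2
  have hΥd : ∀ ζ ∈ ball ζ₀ r, HasDerivAt Υ (ν ζ) ζ := fun ζ hζ => by
    obtain ⟨-, -, c3, c4, -⟩ := hrel ζ hζ
    have hpos := (areaDensity_pos u (X ζ)).ne'
    refine hasDerivAt_of_cauchyRiemann (hsnd ζ hζ)
      ((hg _ (hball ζ hζ).2.1).comp ζ (hXd ζ hζ)) ?_ ?_
    · simp
      field_simp
      linear_combination c3
    · simp
      field_simp
      linear_combination c4
  -- `X` is only known to be `C¹`; `μ` is holomorphic because it is the derivative of the
  -- holomorphic `Ξ`.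
  have hμd : DifferentiableOn ℂ μ (ball ζ₀ r) :=
    Complex.IsExactOn.differentiableOn isOpen_ball ⟨Ξ, hΞd⟩
  have hsq : ∀ ζ ∈ ball ζ₀ r, 1 - ζ ^ 2 ≠ 0 := fun ζ hζ h0 => by
    have h1 := congrArg Complex.re h0
    simp [pow_two] at h1
    nlinarith [hK ζ hζ, sq_nonneg ζ.im]
  set R : ℂ → ℂ := fun ζ => μ ζ / (1 - ζ ^ 2) with hR
  have hRd : DifferentiableOn ℂ R (ball ζ₀ r) :=
    hμd.div (by fun_prop) hsq
  have hRμ : ∀ ζ ∈ ball ζ₀ r, (1 - ζ ^ 2) * R ζ = μ ζ := fun ζ hζ => mul_div_cancel₀ _ (hsq ζ hζ)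
  have hRν : ∀ ζ ∈ ball ζ₀ r, Complex.I * (1 + ζ ^ 2) * R ζ = ν ζ := fun ζ hζ => by
    obtain ⟨c1, c2, -⟩ := hrel ζ hζ
    have := we_proportional (hK ζ hζ).ne' (hPX ζ hζ) (hQX ζ hζ) (hWX ζ hζ) c1 c2 (ζ := ζ)
      (μ := μ ζ) (ν := ν ζ) rfl rfl rfl
    rw [hR, ← mul_div_assoc, ← this, mul_div_cancel_left₀ _ (hsq ζ hζ)]
  have hplane : ∀ ζ ∈ ball ζ₀ r, wePlane p ζ₀ R ζ = X ζ := fun ζ hζ => by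
    have e1 := segIntegral_eq_sub (differentiableOn_weX hRd).continuousOn (F := Ξ)
      (fun w hw => (hRμ w hw).symm ▸ hΞd w hw) hζ
    have e2 := segIntegral_eq_sub (differentiableOn_weY hRd).continuousOn (F := Υ)
      (fun w hw => (hRν w hw).symm ▸ hΥd w hw) hζ
    have h1 : ∀ w, (Ξ w).re = (X w).1 := fun w => rfl
    have h2 : ∀ w, (Υ w).re = (X w).2 := fun w => rfl
    rw [wePlane, e1, e2, Complex.sub_re, Complex.sub_re, h1, h1, h2, h2, hXζ₀]
    simp
  have hud : ∀ ζ ∈ ball ζ₀ r, HasFDerivAt (fun w => u (wePlane p ζ₀ R w))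
      (reMul (2 * ζ * R ζ)) ζ := fun ζ hζ => by
    have hq : wePlane p ζ₀ R ζ ∈ U := hplane ζ hζ ▸ hXU ζ hζ
    have h := (((hu.contDiffOn.differentiableOn (by norm_num)).differentiableAt
      (hU.mem_nhds hq)).hasFDerivAt).comp ζ (hasFDerivAt_wePlane hRd hζ)
    refine HasFDerivAt.congr_fderiv h (ContinuousLinearMap.ext fun v => ?_)
    rw [ContinuousLinearMap.comp_apply, clm_prod_apply, reMul_apply,
      ← slopeX_mul_re_add_slopeY_mul_re (hK ζ hζ).ne', ← hPX ζ hζ, ← hQX ζ hζ, ← hplane ζ hζ]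
    rfl
  refine ⟨ζ₀, r, R, hr, hRd, fun ζ hζ h0 => ?_, fun ζ hζ => hplane ζ hζ ▸ hXU ζ hζ, ?_⟩
  -- A zero of `R` would be a zero of `μ`, so the derivative of `x` would vanish, contradicting the
  -- nonzero Jacobian.
  · obtain ⟨-, -, -, -, hdet⟩ := hrel ζ hζ
    have h1 := hRμ ζ hζ
    rw [h0, mul_zero] at h1
    have e1 : (fderiv ℝ X ζ 1).1 = 0 := (congrArg Complex.re h1).symm
    have e2 : (fderiv ℝ X ζ Complex.I).1 = 0 := by
      simpa [hμ] using congrArg Complex.im h1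
    exact hdet (by rw [e1, e2]; ring)
  -- Both heights have the same derivative on the connected disc and the value `u p` at `ζ₀`.
  · have hw := fun ζ (hζ : ζ ∈ ball ζ₀ r) => hasFDerivAt_weHeight (c := u p) hRd hζ
    refine isOpen_ball.eqOn_of_fderiv_eq (convex_ball ζ₀ r).isPreconnected
      (fun ζ hζ => (hud ζ hζ).differentiableAt.differentiableWithinAt)
      (fun ζ hζ => (hw ζ hζ).differentiableAt.differentiableWithinAt)
      (fun ζ hζ => (hud ζ hζ).fderiv.trans (hw ζ hζ).fderiv.symm) (mem_ball_self hr) (by simp)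

end MinimalGraph

end

theorem theorem3p1 (U : Set (ℝ × ℝ)) (hU : IsOpen U) (u : ℝ × ℝ → ℝ)
    (hu : MinimalGraph.IsMinimalGraph u U) (p : ℝ × ℝ) (hp : p ∈ U)
    (hnu : ¬ MinimalGraph.IsUmbilic u p) :
    -- near a non-umbilical point there is a Weierstrass–Enneper function
    (∃ (ζ₀ : ℂ) (r : ℝ) (R : ℂ → ℂ), MinimalGraph.IsWERepresentation u U p ζ₀ r R) ∧
    ∀ (ζ₀ : ℂ) (r : ℝ) (R : ℂ → ℂ), MinimalGraph.IsWERepresentation u U p ζ₀ r R →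
      -- it can be split into any number of non-vanishing summands
      (∀ n : ℕ, 1 ≤ n → ∃ S : Fin n → ℂ → ℂ, MinimalGraph.IsSplitting ζ₀ r R S) ∧
      -- every splitting yields a decomposition of the height function
      (∀ (n : ℕ) (S : Fin n → ℂ → ℂ), MinimalGraph.IsSplitting ζ₀ r R S →
        ∀ c : Fin n → ℝ, ∑ i, c i = u p →
          ∃ (U' : Set (ℝ × ℝ)) (z : Fin n → ℝ × ℝ → ℝ),
            MinimalGraph.IsDecomposition u U p ζ₀ r R S c U' z) ∧
      -- no decomposition into at least two summands is the only one
      (∀ (n : ℕ), 2 ≤ n → ∀ (S : Fin n → ℂ → ℂ) (c : Fin n → ℝ) (U' : Set (ℝ × ℝ))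
        (z : Fin n → ℝ × ℝ → ℝ), MinimalGraph.IsSplitting ζ₀ r R S →
        MinimalGraph.IsDecomposition u U p ζ₀ r R S c U' z →
          ∃ (S' : Fin n → ℂ → ℂ) (c' : Fin n → ℝ) (U'' : Set (ℝ × ℝ))
            (z' : Fin n → ℝ × ℝ → ℝ), MinimalGraph.IsSplitting ζ₀ r R S' ∧
            MinimalGraph.IsDecomposition u U p ζ₀ r R S' c' U'' z' ∧
            ¬ MinimalGraph.EssentiallyEqual p z z') := by
  have hud : DifferentiableOn ℝ u U := hu.contDiffOn.differentiableOn (by norm_num)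
  exact ⟨hu.exists_isWERepresentation hU hp hnu, fun ζ₀ r R hR =>
    ⟨fun n hn => MinimalGraph.exists_isSplitting hR hn,
      fun n S hS c hc => MinimalGraph.exists_isDecomposition hU hud hR hS hc,
      fun n hn S c U' z hS hz =>
        MinimalGraph.exists_isDecomposition_not_essentiallyEqual hU hud hR hn hS hz⟩⟩
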